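/- Throughout, $\mathbb{N}=\{1,2,3,\dots\}$. For $f\colon\mathbb{N}\to\mathbb{R}$ put $\Delta f(n)=f(n+1)-f(n)$. Let $\mathcal{F}_0$ be the set of all $f\colon\mathbb{N}\to\mathbb{R}$ that are eventually monotone and satisfy $\lim_{n\to\infty}f(n)=0$ and $\left|\sum_{n=1}^\infty f(n)\right|=\infty$, and for $\ell\ge 0$ let $\mathcal{F}_{\ell+1}=\{f\colon\mathbb{N}\to\mathbb{R} : \Delta f\in\mathcal{F}_\ell\}$. A set $R\subset\mathbb{N}$ is called thick if it contains arbitrarily long intervals of consecutive integers. For $W\in\mathcal{F}_1$, a set $R\subset\mathbb{N}$ is called $W$-syndetic if there exists $l\in\mathbb{N}$ such that for all integers $1\le M\le N$ with $W(N)-W(M)\ge l$ one has $$\sum_{n\in R\cap[M,N]}\Delta W(n)\ge 1 .$$ **Theorem.** Let $\ell\ge 0$ be an integer, let $f\in\mathcal{F}_{\ell+1}$ and put $W=\Delta^\ell f$ (so $W\in\mathcal F_1$). Let $(X,\mathcal{B},\mu)$ be a probability space and let $T\colon X\to X$ be an invertible measure preserving transformation, i.e. a bijection such that $T$ and $T^{-1}$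 are measurable and $T$ preserves $\mu$. Then for every $A\in\mathcal{B}$ and every $\varepsilon>0$ the set $$R_{\varepsilon,A}=\left\{n\in\mathbb{N} : \mu\!\left(A\cap T^{-\lfloor f(n)\rfloor}A\right)>\mu(A)^2-\varepsilon\right\}$$ is thick and $W$-syndetic; moreover, it is also $(-W)$-syndetic. (The condition of $W$-syndeticity has content when $W(n)\to+\infty$, and that of $(-W)$-syndeticity when $W(n)\to-\infty$; one of the two cases always occurs.) -/

import Mathlib

open Filter MeasureTheory

noncomputable section

/-- The classes `F_ℓ` of real sequences indexed by the positive integers; the value at the index `0`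
of a function `f : ℕ → ℝ` never plays a role.
`F_0`: eventually monotone, tending to `0`, with `|∑ f(n)| = ∞`.
`F_{ℓ+1}`: those `f` whose forward difference `Δ f (n) = f (n + 1) - f n` lies in `F_ℓ`. -/
def ClassF : ℕ → Set (ℕ → ℝ)
  | 0 => {f | (∃ n₀ : ℕ, MonotoneOn f (Set.Ici n₀) ∨ AntitoneOn f (Set.Ici n₀)) ∧
      Tendsto f atTop (nhds 0) ∧
      Tendsto (fun N : ℕ => |∑ n ∈ Finset.Icc 1 N, f n|) atTop atTop}
  | ℓ + 1 => {f | fwdDiff (1 : ℕ) f ∈ ClassF ℓ}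

/-- A set of positive integers is thick if it contains arbitrarily long intervals
`{a, a + 1, …, a + L}`. -/
def IsThick (R : Set ℕ) : Prop :=
  ∀ L : ℕ, ∃ a : ℕ, 0 < a ∧ ∀ n ∈ Finset.Icc a (a + L), n ∈ R

open Classical in
/-- A set `R` of positive integers is `W`-syndetic if there is a positive integer `l` such that
`∑_{n ∈ R ∩ [M, N]} ΔW(n) ≥ 1` for every interval `[M, N]` of positive integers with
`W(N) - W(M) ≥ l`. -/
def IsWSyndetic (W : ℕ → ℝ) (R : Set ℕ) : Prop :=
  ∃ l : ℕ, 0 < l ∧ ∀ M N : ℕ, 0 < M → M ≤ N → (l : ℝ) ≤ W N - W M →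
    1 ≤ ∑ n ∈ Finset.Icc M N with n ∈ R, fwdDiff (1 : ℕ) W n

/-- The set of the positive integers `n` with `μ(A ∩ T^{-⌊f(n)⌋} A) > μ(A)² - ε`. Here
`T^{-k} A` is the preimage of `A` under the integer power `T ^ k` of the bijection `T`. -/
def returnSet {X : Type*} [MeasurableSpace X] (μ : Measure X) (T : X ≃ᵐ X) (f : ℕ → ℝ)
    (A : Set X) (ε : ℝ) : Set ℕ :=
  {n | 0 < n ∧
    μ.real A ^ 2 - ε < μ.real (A ∩ ⇑((T.toEquiv : Equiv.Perm X) ^ ⌊f n⌋) ⁻¹' A)}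

end

/-! The centred correlations `v k = μ(A ∩ T^{-k} A) - μ(A)²` are positive definite on ℤ, so by
Herglotz' theorem they are the Fourier coefficients of a finite measure `σ` on [0, 2π]. It is enough
to show, for every `L`, that the set of `n` with `v ⌊f (n + h)⌋ > -ε` for all `h ≤ L` has positive
lower density with respect to the weights `ΔV`, where `V` is a tail of `W` or `-W`. A single such
`n` gives an interval of returns, hence thickness, and the density for `L = 0` gives syndeticity
(`IsWeight.exists_density`, `isWSyndetic_of_density`).

Split `σ` into finitely many atoms, an atomless part `τ` and a small error. Along `f` the transform
of `τ` is small outside a set of density zero, by Wiener's lemma. The atoms contribute almost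
nonnegatively when every `f (n + h)` lies just to the right of an integer and `exp (i θ f (n + h))`
is near 1 at each atom `θ`: a Bohr condition on finitely many characters of `f - δ`.

That Bohr set has positive density without any joint equidistribution (`IsWeight.exists_kernel`). A
product of powers of `(1 + cos) / 2` is a positive constant plus a nonnegative combination of
sequences `exp (i ∑ pⱼ f (n + j))`. By `IsWeight.shiftComb_dichotomy` each of these has mean 0
(Weyl) or tends to 1, so the mean of the product is at least the constant. Weyl's criterion is
proved by induction on the order of differencing, using van der Corput's trick for `ΔV`-weighted
averages. -/

open scoped NNReal Polynomial

/-! ### Weighted averages over long windows and van der Corput's trick. -/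

/-- `V` is a sequence with antitone increments tending to `0` which itself tends to `∞`. -/
structure IsWeight (V : ℕ → ℝ) : Prop where
  anti : Antitone (fwdDiff (1 : ℕ) V)
  lim : Tendsto (fwdDiff (1 : ℕ) V) atTop (nhds 0)
  unbdd : Tendsto V atTop atTop

/-- The filter of the windows `[M, N)` with `V N - V M → ∞`. -/
def windows (V : ℕ → ℝ) : Filter (ℕ × ℕ) := comap (fun p => V p.2 - V p.1) atTop

/-- The average of `a` over the window `[p.1, p.2)` with the weights `ΔV`. -/
noncomputable def wavg (V : ℕ → ℝ) (a : ℕ → ℂ) (p : ℕ × ℕ) : ℂ :=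
  (∑ n ∈ Finset.Ico p.1 p.2, ((fwdDiff (1 : ℕ) V n : ℝ) : ℂ) * a n) / ((V p.2 - V p.1 : ℝ) : ℂ)

instance (V : ℕ → ℝ) : (windows V).IsCountablyGenerated := by
  unfold windows; infer_instance

lemma sum_Ico_fwdDiff (V : ℕ → ℝ) {M N : ℕ} (h : M ≤ N) :
    ∑ n ∈ Finset.Ico M N, fwdDiff (1 : ℕ) V n = V N - V M := by
  simpa [fwdDiff] using Finset.sum_Ico_sub V h

lemma wavg_add (V : ℕ → ℝ) (a b : ℕ → ℂ) (p : ℕ × ℕ) :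
    wavg V (fun n => a n + b n) p = wavg V a p + wavg V b p := by
  simp [wavg, mul_add, Finset.sum_add_distrib, add_div]

lemma wavg_const_mul (V : ℕ → ℝ) (c : ℂ) (a : ℕ → ℂ) (p : ℕ × ℕ) :
    wavg V (fun n => c * a n) p = c * wavg V a p := by
  simp only [wavg, mul_left_comm _ c, ← Finset.mul_sum, mul_div_assoc]

lemma wavg_sub (V : ℕ → ℝ) (a b : ℕ → ℂ) (p : ℕ × ℕ) :
    wavg V (fun n => a n - b n) p = wavg V a p - wavg V b p := by
  simp [wavg, mul_sub, Finset.sum_sub_distrib, sub_div]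

lemma wavg_sum (V : ℕ → ℝ) {ι : Type*} (s : Finset ι) (a : ι → ℕ → ℂ) (p : ℕ × ℕ) :
    wavg V (fun n => ∑ i ∈ s, a i n) p = ∑ i ∈ s, wavg V (a i) p := by
  simp only [wavg, Finset.mul_sum, ← Finset.sum_div]
  rw [Finset.sum_comm]

lemma wavg_conj (V : ℕ → ℝ) (a : ℕ → ℂ) (p : ℕ × ℕ) :
    wavg V (fun n => (starRingEnd ℂ) (a n)) p = (starRingEnd ℂ) (wavg V a p) := by
  simp only [wavg, map_div₀, map_sum, map_mul, Complex.conj_ofReal]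

lemma wavg_ofReal (V : ℕ → ℝ) (a : ℕ → ℝ) (p : ℕ × ℕ) :
    wavg V (fun n => (a n : ℂ)) p =
      (((∑ n ∈ Finset.Ico p.1 p.2, fwdDiff (1 : ℕ) V n * a n) / (V p.2 - V p.1) : ℝ) : ℂ) := by
  simp [wavg]

namespace IsWeight

variable {V : ℕ → ℝ} (hV : IsWeight V)
include hV

lemma nonneg (n : ℕ) : 0 ≤ fwdDiff (1 : ℕ) V n := hV.anti.le_of_tendsto hV.lim n

lemma monotone : Monotone V :=
  monotone_nat_of_le_succ fun n => by simpa [fwdDiff] using hV.nonneg n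

omit hV in
lemma eventually_gt (C : ℝ) : ∀ᶠ p in windows V, C < V p.2 - V p.1 :=
  tendsto_comap.eventually (eventually_gt_atTop C)

lemma eventually_le : ∀ᶠ p in windows V, p.1 ≤ p.2 := by
  filter_upwards [eventually_gt (V := V) 0] with p hp
  by_contra! h
  linarith [hV.monotone h.le]

lemma neBot : (windows V).NeBot := by
  refine comap_neBot fun s hs => ?_
  obtain ⟨C, hC⟩ := mem_atTop_sets.1 hs
  obtain ⟨N, hN⟩ := (hV.unbdd.eventually_ge_atTop (C + V 0)).exists
  exact ⟨(0, N), hC _ (by simpa using by linarith)⟩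

lemma norm_sum_le (a : ℕ → ℂ) (M N : ℕ) :
    ‖∑ n ∈ Finset.Ico M N, ((fwdDiff (1 : ℕ) V n : ℝ) : ℂ) * a n‖ ≤
      ∑ n ∈ Finset.Ico M N, fwdDiff (1 : ℕ) V n * ‖a n‖ := by
  refine (_root_.norm_sum_le _ _).trans_eq (Finset.sum_congr rfl fun n _ => ?_)
  rw [norm_mul, Complex.norm_real, Real.norm_of_nonneg (hV.nonneg n)]

lemma norm_wavg_le_of_lt {a : ℕ → ℂ} {C : ℝ} (ha : ∀ n, ‖a n‖ ≤ C) {p : ℕ × ℕ}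
    (hp : 0 < V p.2 - V p.1) (hle : p.1 ≤ p.2) : ‖wavg V a p‖ ≤ C := by
  rw [wavg, norm_div, Complex.norm_real, Real.norm_of_nonneg hp.le, div_le_iff₀ hp]
  refine (hV.norm_sum_le a _ _).trans ?_
  rw [← sum_Ico_fwdDiff V hle, Finset.mul_sum]
  exact Finset.sum_le_sum fun n _ => by
    rw [mul_comm]; exact mul_le_mul_of_nonneg_right (ha n) (hV.nonneg n)

lemma norm_wavg_le {a : ℕ → ℂ} {C : ℝ} (ha : ∀ n, ‖a n‖ ≤ C) :
    ∀ᶠ p in windows V, ‖wavg V a p‖ ≤ C := by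
  filter_upwards [eventually_gt (V := V) 0, hV.eventually_le] with p hp hle
  exact hV.norm_wavg_le_of_lt ha hp hle

lemma wavg_const (c : ℂ) : ∀ᶠ p in windows V, wavg V (fun _ => c) p = c := by
  filter_upwards [eventually_gt (V := V) 0, hV.eventually_le] with p hp hle
  rw [wavg, ← Finset.sum_mul, ← Complex.ofReal_sum, sum_Ico_fwdDiff V hle, mul_div_assoc,
    mul_comm, div_mul_cancel₀]
  exact_mod_cast hp.ne'

omit hV in
/-- A weighted sum that is `O(1) + ε (V N - V M)` for all `ε > 0` has averages tending to `0`. -/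
lemma tendsto_wavg_zero_of_bound {a : ℕ → ℂ}
    (h : ∀ ε > 0, ∃ C, ∀ M N : ℕ, M ≤ N → V M ≤ V N →
      ‖∑ n ∈ Finset.Ico M N, ((fwdDiff (1 : ℕ) V n : ℝ) : ℂ) * a n‖ ≤ C + ε * (V N - V M))
    (hle : ∀ᶠ p in windows V, p.1 ≤ p.2) :
    Tendsto (wavg V a) (windows V) (nhds 0) := by
  rw [Metric.tendsto_nhds]
  intro ε hε
  obtain ⟨C, hC⟩ := h (ε / 2) (by positivity)
  filter_upwards [eventually_gt (V := V) 0, eventually_gt (V := V) (C / (ε / 2)), hle]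
    with p hp hp' hle
  rw [dist_zero_right, wavg, norm_div, Complex.norm_real, Real.norm_of_nonneg hp.le, div_lt_iff₀ hp]
  have := hC p.1 p.2 hle (by linarith)
  rw [div_lt_iff₀ (by positivity)] at hp'
  linarith

lemma tendsto_wavg_zero {a : ℕ → ℂ} (ha : Tendsto a atTop (nhds 0)) :
    Tendsto (wavg V a) (windows V) (nhds 0) := by
  refine tendsto_wavg_zero_of_bound (fun ε hε => ?_) hV.eventually_le
  obtain ⟨K, hK⟩ := Metric.tendsto_atTop.1 ha ε hε
  refine ⟨∑ n ∈ Finset.range K, fwdDiff (1 : ℕ) V n * ‖a n‖, fun M N hMN _ => ?_⟩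
  refine (hV.norm_sum_le a M N).trans ?_
  have h0 : ∀ n, 0 ≤ fwdDiff (1 : ℕ) V n * ‖a n‖ := fun n => mul_nonneg (hV.nonneg n) (norm_nonneg _)
  rw [← sum_Ico_fwdDiff V hMN, ← Finset.sum_filter_add_sum_filter_not _ (fun n => n < K),
    Finset.mul_sum]
  refine add_le_add (Finset.sum_le_sum_of_subset_of_nonneg (fun n hn => ?_) fun n _ _ => h0 n) ?_
  · simpa using (Finset.mem_filter.1 hn).2
  · refine (Finset.sum_le_sum fun n hn => ?_).trans
      (Finset.sum_le_sum_of_subset_of_nonneg (Finset.filter_subset _ _) fun n _ _ =>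
        mul_nonneg hε.le (hV.nonneg n))
    have := hK n (by simpa using (Finset.mem_filter.1 hn).2)
    rw [dist_zero_right] at this
    rw [mul_comm]
    exact mul_le_mul_of_nonneg_right this.le (hV.nonneg n)

/-- Abel summation: the weights decrease, so their variation telescopes. The bound does not depend
on the window, which makes the averages asymptotically shift invariant. -/
lemma norm_sum_shift_sub_le {a : ℕ → ℂ} {C : ℝ} (ha : ∀ n, ‖a n‖ ≤ C) {M N : ℕ} (h : M ≤ N) :
    ‖∑ n ∈ Finset.Ico M N, ((fwdDiff (1 : ℕ) V n : ℝ) : ℂ) * (a (n + 1) - a n)‖ ≤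
      2 * C * fwdDiff (1 : ℕ) V 0 := by
  set w := fwdDiff (1 : ℕ) V with hw
  have key : ∑ n ∈ Finset.Ico M N, (w n : ℂ) * (a (n + 1) - a n) =
      w N * a N - w M * a M + ∑ n ∈ Finset.Ico M N, ((w n - w (n + 1) : ℝ) : ℂ) * a (n + 1) := by
    induction N, h using Nat.le_induction with
    | base => simp
    | succ N h ih =>
      rw [Finset.sum_Ico_succ_top h, Finset.sum_Ico_succ_top h, ih]
      push_cast; ring
  have hC : 0 ≤ C := (norm_nonneg _).trans (ha 0)
  have hn : ∀ n, ‖(w n : ℂ)‖ = w n := fun n => by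
    rw [Complex.norm_real, Real.norm_of_nonneg (hV.nonneg n)]
  have h1 : ‖∑ n ∈ Finset.Ico M N, ((w n - w (n + 1) : ℝ) : ℂ) * a (n + 1)‖ ≤ (w M - w N) * C := by
    rw [show w M - w N = ∑ n ∈ Finset.Ico M N, (w n - w (n + 1)) by
      simpa using (congrArg Neg.neg (Finset.sum_Ico_sub w h)).symm, Finset.sum_mul]
    refine norm_sum_le_of_le _ fun n _ => ?_
    have : 0 ≤ w n - w (n + 1) := sub_nonneg.2 (hV.anti n.le_succ)
    rw [norm_mul, Complex.norm_real, Real.norm_of_nonneg this]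
    exact mul_le_mul_of_nonneg_left (ha _) this
  rw [key]
  refine (norm_add_le _ _).trans ((add_le_add ((norm_sub_le _ _).trans_eq rfl) h1).trans ?_)
  rw [norm_mul, norm_mul, hn, hn]
  have h2 := mul_le_mul_of_nonneg_left (ha N) (hV.nonneg N)
  have h3 := mul_le_mul_of_nonneg_left (ha M) (hV.nonneg M)
  have h4 := mul_le_mul_of_nonneg_right (hV.anti M.zero_le) hC
  rw [← hw] at *
  linarith

lemma tendsto_wavg_shift_sub {a : ℕ → ℂ} {C : ℝ} (ha : ∀ n, ‖a n‖ ≤ C) (h : ℕ) :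
    Tendsto (fun p => wavg V (fun n => a (n + h)) p - wavg V a p) (windows V) (nhds 0) := by
  induction h with
  | zero => simpa using tendsto_const_nhds
  | succ h ih =>
    have : Tendsto (wavg V fun n => a (n + h + 1) - a (n + h)) (windows V) (nhds 0) := by
      refine tendsto_wavg_zero_of_bound (fun ε hε => ?_) hV.eventually_le
      refine ⟨2 * C * fwdDiff (1 : ℕ) V 0, fun M N hMN hle => ?_⟩
      have h1 := hV.norm_sum_shift_sub_le (a := fun n => a (n + h)) (fun n => ha _) hMN
      have h2 := mul_nonneg hε.le (sub_nonneg.2 hle)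
      simp only [add_right_comm _ 1 h] at h1
      linarith
    refine (this.add ih).congr' (Eventually.of_forall fun p => ?_) |>.trans (by simp)
    simp only [wavg_sub, ← add_assoc]
    ring

lemma tendsto_wavg_shift {a : ℕ → ℂ} {C : ℝ} (ha : ∀ n, ‖a n‖ ≤ C) {x : ℂ}
    (hx : Tendsto (wavg V a) (windows V) (nhds x)) (h : ℕ) :
    Tendsto (wavg V fun n => a (n + h)) (windows V) (nhds x) := by
  simpa using (hV.tendsto_wavg_shift_sub ha h).add hx

/-- Cauchy–Schwarz, each weight being split into two square roots. -/
lemma norm_wavg_sq_le (b : ℕ → ℂ) :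
    ∀ᶠ p in windows V, ‖wavg V b p‖ ^ 2 ≤ (wavg V (fun n => ((‖b n‖ ^ 2 : ℝ) : ℂ)) p).re := by
  filter_upwards [eventually_gt (V := V) 0, hV.eventually_le] with p hp hle
  rw [wavg_ofReal, Complex.ofReal_re, wavg, norm_div, Complex.norm_real, Real.norm_of_nonneg hp.le,
    div_pow, div_le_div_iff₀ (by positivity) hp]
  have h1 := hV.norm_sum_le b p.1 p.2
  have h2 := Finset.sum_mul_sq_le_sq_mul_sq (Finset.Ico p.1 p.2)
    (fun n => √(fwdDiff (1 : ℕ) V n)) (fun n => √(fwdDiff (1 : ℕ) V n) * ‖b n‖)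
  simp only [mul_pow, ← mul_assoc, Real.sq_sqrt (hV.nonneg _), Real.mul_self_sqrt (hV.nonneg _)]
    at h2
  rw [sum_Ico_fwdDiff V hle] at h2
  have h3 := (pow_le_pow_left₀ (norm_nonneg _) h1 2).trans h2
  nlinarith

/-- The van der Corput trick for weighted averages. -/
lemma vanDerCorput {a : ℕ → ℂ} (ha : ∀ n, ‖a n‖ ≤ 1)
    (h : ∀ d : ℕ, 0 < d → Tendsto (wavg V fun n => a (n + d) * (starRingEnd ℂ) (a n))
      (windows V) (nhds 0)) :
    Tendsto (wavg V a) (windows V) (nhds 0) := by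
  have hb : ∀ d n, ‖a (n + d) * (starRingEnd ℂ) (a n)‖ ≤ 1 := fun d n => by
    rw [norm_mul, RCLike.norm_conj]
    exact mul_le_one₀ (ha _) (norm_nonneg _) (ha _)
  have hlt : ∀ i j : ℕ, i < j → Tendsto (wavg V fun n => a (n + j) * (starRingEnd ℂ) (a (n + i)))
      (windows V) (nhds 0) := fun i j hij => by
    have := hV.tendsto_wavg_shift (hb (j - i)) (h (j - i) (by omega)) i
    refine this.congr fun p => ?_
    simp only [add_assoc, Nat.add_sub_cancel' hij.le]
  have hne : ∀ i j : ℕ, i ≠ j → Tendsto (wavg V fun n => a (n + j) * (starRingEnd ℂ) (a (n + i)))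
      (windows V) (nhds 0) := fun i j hij => by
    rcases hij.lt_or_gt with h' | h'
    · exact hlt i j h'
    · have := (Complex.continuous_conj.tendsto _).comp (hlt j i h')
      rw [map_zero] at this
      refine this.congr fun p => ?_
      simp only [Function.comp, ← wavg_conj, map_mul, Complex.conj_conj, mul_comm]
  -- By shift invariance the average of `b`, a sum of `H` translates of `a`, is within 1 of `H`
  -- times that of `a`. In the average of `‖b‖²` the diagonal gives at most `H` and the off-diagonal
  -- correlations tend to 0.
  have bound : ∀ H : ℕ, 0 < H → ∀ᶠ p in windows V, ‖wavg V a p‖ ≤ (√(H + 1) + 1) / H := by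
    intro H hH
    let b : ℕ → ℂ := fun n => ∑ i ∈ Finset.range H, a (n + i)
    let o : ℕ → ℂ := fun n => ∑ j ∈ Finset.range H, ∑ i ∈ Finset.range H,
      if i = j then 0 else a (n + j) * (starRingEnd ℂ) (a (n + i))
    let d : ℕ → ℂ := fun n => ∑ j ∈ Finset.range H, a (n + j) * (starRingEnd ℂ) (a (n + j))
    have hbo : ∀ n, ((‖b n‖ ^ 2 : ℝ) : ℂ) = d n + o n := fun n => by
      have h1 : ((‖b n‖ ^ 2 : ℝ) : ℂ) = b n * (starRingEnd ℂ) (b n) := by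
        rw [Complex.mul_conj, Complex.normSq_eq_norm_sq]
      rw [h1, map_sum, Finset.sum_mul_sum, ← Finset.sum_add_distrib]
      refine Finset.sum_congr rfl fun j hj => ?_
      rw [← Finset.add_sum_erase _ _ hj, ← Finset.add_sum_erase (Finset.range H)
        (fun i => if i = j then (0 : ℂ) else a (n + j) * (starRingEnd ℂ) (a (n + i))) hj,
        if_pos rfl, zero_add]
      congr 1
      exact Finset.sum_congr rfl fun i hi => by rw [if_neg (Finset.ne_of_mem_erase hi)]
    have ho : Tendsto (wavg V o) (windows V) (nhds 0) := by
      have : Tendsto (fun p => ∑ j ∈ Finset.range H, ∑ i ∈ Finset.range H,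
          wavg V (fun n => if i = j then 0 else a (n + j) * (starRingEnd ℂ) (a (n + i))) p)
          (windows V) (nhds (∑ j ∈ Finset.range H, ∑ i ∈ Finset.range H, 0)) := by
        refine tendsto_finsetSum _ fun j _ => tendsto_finsetSum _ fun i _ => ?_
        by_cases hij : i = j
        · simp only [hij, if_true]
          exact tendsto_const_nhds.congr fun p => by simp [wavg]
        · simpa [hij] using hne i j hij
      simp only [Finset.sum_const_zero] at this
      refine this.congr fun p => ?_
      simp only [o, wavg_sum]
    have hd : ∀ᶠ p in windows V, ‖wavg V d p‖ ≤ H := hV.norm_wavg_le fun n => by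
      refine (norm_sum_le_of_le (f := fun j => a (n + j) * (starRingEnd ℂ) (a (n + j)))
        (n := fun _ => 1) _ fun j _ => ?_).trans (by simp)
      simpa using hb 0 (n + j)
    have hs : Tendsto (fun p => wavg V b p - H * wavg V a p) (windows V) (nhds 0) := by
      have := tendsto_finsetSum (Finset.range H) fun i _ => hV.tendsto_wavg_shift_sub ha i
      simp only [Finset.sum_const_zero] at this
      refine this.congr fun p => ?_
      simp [b, wavg_sum, Finset.sum_sub_distrib]
    filter_upwards [hd, hV.norm_wavg_sq_le b, (Metric.tendsto_nhds.1 ho) 1 one_pos,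
      (Metric.tendsto_nhds.1 hs) 1 one_pos] with p h1 h2 h3 h4
    rw [dist_zero_right] at h3 h4
    have h5 : ‖wavg V b p‖ ^ 2 ≤ H + 1 := by
      refine h2.trans ((Complex.re_le_norm _).trans ?_)
      simp only [hbo, wavg_add]
      exact (norm_add_le _ _).trans (add_le_add h1 h3.le)
    have h6 := Real.le_sqrt_of_sq_le h5
    rw [le_div_iff₀ (by positivity)]
    have h7 : ‖(H : ℂ) * wavg V a p‖ = ‖wavg V a p‖ * H := by
      rw [norm_mul, mul_comm, Complex.norm_natCast]
    have h8 := norm_sub_norm_le ((H : ℂ) * wavg V a p) (wavg V b p)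
    rw [norm_sub_rev] at h8
    linarith
  rw [Metric.tendsto_nhds]
  intro ε hε
  have hlim : Tendsto (fun H : ℕ => (√((H : ℝ) + 1) + 1) / H) atTop (nhds 0) := by
    have h1 : Tendsto (fun H : ℕ => (3 : ℝ) / √(H : ℝ)) atTop (nhds 0) :=
      tendsto_const_nhds.div_atTop (Real.tendsto_sqrt_atTop.comp tendsto_natCast_atTop_atTop)
    refine squeeze_zero' (Eventually.of_forall fun _ => by positivity) ?_ h1
    filter_upwards [eventually_ge_atTop 1] with H hH
    have hH' : (1 : ℝ) ≤ H := by exact_mod_cast hH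
    have h2 : 1 ≤ √(H : ℝ) := Real.one_le_sqrt.2 hH'
    have h3 : √((H : ℝ) + 1) ≤ 2 * √(H : ℝ) := by
      rw [Real.sqrt_le_left (by positivity), mul_pow, Real.sq_sqrt (by positivity)]
      linarith
    rw [div_le_div_iff₀ (by positivity) (by positivity)]
    have h4 := Real.mul_self_sqrt (show (0 : ℝ) ≤ H by positivity)
    nlinarith
  obtain ⟨H, hH, hH0⟩ := ((hlim.eventually (gt_mem_nhds hε)).and (eventually_gt_atTop 0)).exists
  filter_upwards [bound H hH0] with p hp
  rw [dist_zero_right]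
  exact hp.trans_lt hH

end IsWeight

/-! ### Exponentials and Weyl's criterion for weighted averages. -/

/-- The point `exp (i t)` of the unit circle. -/
noncomputable def cis (t : ℝ) : ℂ := Complex.exp (t * Complex.I)

lemma norm_cis (t : ℝ) : ‖cis t‖ = 1 := Complex.norm_exp_ofReal_mul_I t

lemma cis_add (s t : ℝ) : cis (s + t) = cis s * cis t := by
  simp [cis, add_mul, Complex.exp_add]

lemma conj_cis (t : ℝ) : (starRingEnd ℂ) (cis t) = cis (-t) := by
  simp [cis, ← Complex.exp_conj]

@[simp] lemma cis_zero : cis 0 = 1 := by simp [cis]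

lemma cis_re (t : ℝ) : (cis t).re = Real.cos t := Complex.exp_ofReal_mul_I_re t

lemma continuous_cis : Continuous cis := by unfold cis; fun_prop

lemma norm_cis_sub_one_le (t : ℝ) : ‖cis t - 1‖ ≤ |t| := by
  simpa [cis, mul_comm] using Real.norm_exp_I_mul_ofReal_sub_one_le (x := t)

lemma norm_cis_sub_cis_le (s t : ℝ) : ‖cis s - cis t‖ ≤ |s - t| := by
  have : cis s - cis t = cis t * (cis (s - t) - 1) := by
    rw [mul_sub, ← cis_add, mul_one, add_sub_cancel]
  rw [this, norm_mul, norm_cis, one_mul]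
  exact norm_cis_sub_one_le _

lemma norm_cis_sub_one_sub_le (t : ℝ) : ‖cis t - 1 - t * Complex.I‖ ≤ 3 * t ^ 2 := by
  rcases le_total |t| 1 with h | h
  · have := Complex.norm_exp_sub_one_sub_id_le (x := t * Complex.I) (by simpa using h)
    simp only [norm_mul, Complex.norm_I, mul_one, Complex.norm_real, Real.norm_eq_abs, sq_abs]
      at this
    exact this.trans (by nlinarith [sq_nonneg t])
  · have h1 := norm_cis_sub_one_le t
    have h2 := norm_sub_le (cis t - 1) (t * Complex.I)
    simp only [norm_mul, Complex.norm_I, mul_one, Complex.norm_real, Real.norm_eq_abs] at h2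
    rw [← sq_abs]
    nlinarith

namespace IsWeight

variable {V : ℕ → ℝ} (hV : IsWeight V)
include hV

/-- The sum is a Riemann sum for the integral of `exp (i α v)`, which is bounded on every interval.
The error per step is quadratic in the weight, hence small relative to the weight. -/
lemma tendsto_wavg_cis_mul {α : ℝ} (hα : α ≠ 0) :
    Tendsto (wavg V fun n => cis (α * V n)) (windows V) (nhds 0) := by
  refine tendsto_wavg_zero_of_bound (fun ε hε => ?_) hV.eventually_le
  set w := fwdDiff (1 : ℕ) V with hw
  have hα' : 0 < |α| := abs_pos.2 hα
  obtain ⟨K, hK⟩ := Metric.tendsto_atTop.1 hV.lim (ε / (3 * |α|)) (by positivity)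
  -- The 2 bounds the two endpoints of the telescoping sum. The rest covers the squared weights
  -- before `K`; beyond `K` they cost at most `ε (V N - V M)`.
  refine ⟨2 / |α| + 3 * |α| * ∑ n ∈ Finset.range K, w n ^ 2, fun M N hMN hle => ?_⟩
  have key : (α * Complex.I) * ∑ n ∈ Finset.Ico M N, (w n : ℂ) * cis (α * V n) =
      (cis (α * V N) - cis (α * V M)) -
        ∑ n ∈ Finset.Ico M N, cis (α * V n) * (cis (α * w n) - 1 - (α * w n : ℝ) * Complex.I) := by
    rw [← Finset.sum_Ico_sub (fun n => cis (α * V n)) hMN, ← Finset.sum_sub_distrib,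
      Finset.mul_sum]
    refine Finset.sum_congr rfl fun n _ => ?_
    have : cis (α * V (n + 1)) = cis (α * V n) * cis (α * w n) := by
      rw [← cis_add, hw]; congr 1; simp only [fwdDiff]; ring
    rw [this]; push_cast; ring
  have h2 : ‖∑ n ∈ Finset.Ico M N, cis (α * V n) *
      (cis (α * w n) - 1 - (α * w n : ℝ) * Complex.I)‖ ≤
      3 * α ^ 2 * ∑ n ∈ Finset.Ico M N, w n ^ 2 := by
    rw [Finset.mul_sum]
    refine norm_sum_le_of_le _ fun n _ => ?_
    rw [norm_mul, norm_cis, one_mul]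
    exact (norm_cis_sub_one_sub_le _).trans_eq (by ring)
  have h3 : ∑ n ∈ Finset.Ico M N, w n ^ 2 ≤
      ∑ n ∈ Finset.range K, w n ^ 2 + ε / (3 * |α|) * (V N - V M) := by
    rw [← sum_Ico_fwdDiff V hMN, ← Finset.sum_filter_add_sum_filter_not _ (fun n => n < K),
      Finset.mul_sum]
    refine add_le_add (Finset.sum_le_sum_of_subset_of_nonneg (fun n hn => ?_)
      fun n _ _ => sq_nonneg _) ?_
    · simpa using (Finset.mem_filter.1 hn).2
    · refine (Finset.sum_le_sum fun n hn => ?_).trans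
        (Finset.sum_le_sum_of_subset_of_nonneg (Finset.filter_subset _ _) fun n _ _ =>
          mul_nonneg (by positivity) (hV.nonneg n))
      have := hK n (by simpa using (Finset.mem_filter.1 hn).2)
      rw [dist_zero_right, Real.norm_of_nonneg (hV.nonneg n)] at this
      rw [sq]
      exact mul_le_mul_of_nonneg_right this.le (hV.nonneg n)
  have h4 : |α| * ‖∑ n ∈ Finset.Ico M N, (w n : ℂ) * cis (α * V n)‖ ≤
      2 + 3 * α ^ 2 * ∑ n ∈ Finset.Ico M N, w n ^ 2 := by
    have := congrArg norm key
    rw [norm_mul, norm_mul, Complex.norm_I, mul_one, Complex.norm_real, Real.norm_eq_abs] at this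
    rw [this]
    refine (norm_sub_le _ _).trans (add_le_add ((norm_sub_le _ _).trans ?_) h2)
    rw [norm_cis, norm_cis]; norm_num
  rw [← mul_le_mul_iff_right₀ hα']
  refine h4.trans ?_
  have h5 := mul_le_mul_of_nonneg_left h3 (show 0 ≤ 3 * α ^ 2 by positivity)
  refine (add_le_add_right h5 2).trans_eq ?_
  rw [← sq_abs α]
  field_simp
  ring

lemma tendsto_wavg_cis_of_tendsto {g : ℕ → ℝ} {α c : ℝ} (hα : α ≠ 0)
    (hg : Tendsto (fun n => g n - α * V n) atTop (nhds c)) :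
    Tendsto (wavg V fun n => cis (g n)) (windows V) (nhds 0) := by
  have h1 : Tendsto (fun n => cis (g n) - cis c * cis (α * V n)) atTop (nhds 0) := by
    rw [tendsto_zero_iff_norm_tendsto_zero]
    have h2 : Tendsto (fun n => |g n - α * V n - c|) atTop (nhds 0) := by
      simpa using (hg.sub_const c).abs
    refine squeeze_zero (fun _ => norm_nonneg _) (fun n => ?_) h2
    rw [← cis_add]
    refine (norm_cis_sub_cis_le _ _).trans_eq ?_
    congr 1; ring
  have h3 := (hV.tendsto_wavg_zero h1).add ((hV.tendsto_wavg_cis_mul hα).const_mul (cis c))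
  simp only [mul_zero, add_zero] at h3
  refine h3.congr fun p => ?_
  rw [wavg_sub, wavg_const_mul, sub_add_cancel]

lemma tendsto_add_sub (h : ℕ) : Tendsto (fun n => V (n + h) - V n) atTop (nhds 0) := by
  induction h with
  | zero => simp
  | succ h ih =>
    have := (hV.lim.comp (tendsto_add_atTop_nat h)).add ih
    rw [add_zero] at this
    refine this.congr fun n => ?_
    simp only [Function.comp, fwdDiff, add_assoc]
    ring

/-- Weyl's equidistribution criterion along sequences whose `k`-th difference is close to `α V`. -/
lemma tendsto_wavg_cis {k : ℕ} {g : ℕ → ℝ} {α c : ℝ} (hα : α ≠ 0)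
    (hg : Tendsto (fun n => (fwdDiff (1 : ℕ))^[k] g n - α * V n) atTop (nhds c)) :
    Tendsto (wavg V fun n => cis (g n)) (windows V) (nhds 0) := by
  induction k generalizing g α c with
  | zero => exact hV.tendsto_wavg_cis_of_tendsto hα hg
  | succ k ih =>
    refine hV.vanDerCorput (fun n => (norm_cis _).le) fun d hd => ?_
    -- The `k`-th difference of `g (n + d) - g n` is a sum of `d` values of the `(k + 1)`-st
    -- difference of `g`, hence is `d α V n` plus a convergent sequence.
    have h1 : Tendsto (fun n => ∑ i ∈ Finset.range d,
        (((fwdDiff (1 : ℕ))^[k + 1] g (n + i) - α * V (n + i)) + α * (V (n + i) - V n)))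
        atTop (nhds (∑ i ∈ Finset.range d, (c + α * 0))) :=
      tendsto_finsetSum _ fun i _ =>
        (hg.comp (tendsto_add_atTop_nat i)).add ((hV.tendsto_add_sub i).const_mul α)
    have h2 := ih (g := fun n => g (n + d) - g n) (α := d * α) (by positivity) (h1.congr fun n => ?_)
    · refine h2.congr fun p => ?_
      simp only [conj_cis, ← cis_add, sub_eq_add_neg]
    · have h3 : (fwdDiff (1 : ℕ))^[k] (fun n => g (n + d) - g n) n =
          (fwdDiff (1 : ℕ))^[k] g (n + d) - (fwdDiff (1 : ℕ))^[k] g n := by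
        have : (fun n => g (n + d) - g n) = (fun n => g (n + d)) + (-1 : ℝ) • g := by
          ext n; simp [sub_eq_add_neg]
        rw [this, fwdDiff_iter_add, fwdDiff_iter_const_smul]
        simp [fwdDiff_iter_comp_add, sub_eq_add_neg]
      have h4 := Finset.sum_range_sub (fun i => (fwdDiff (1 : ℕ))^[k] g (n + i)) d
      rw [add_zero] at h4
      rw [h3, ← h4]
      have h5 : (d * α) * V n = ∑ _i ∈ Finset.range d, α * V n := by simp [mul_assoc]
      rw [h5, ← Finset.sum_sub_distrib]
      refine Finset.sum_congr rfl fun i _ => ?_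
      rw [Function.iterate_succ_apply', fwdDiff, add_assoc]
      ring

end IsWeight

/-! ### Polynomials in the shift operator. -/

/-- The shift `u ↦ u (· + 1)` on real sequences. -/
def shiftEnd : Module.End ℝ (ℕ → ℝ) := LinearMap.funLeft ℝ ℝ Nat.succ

/-- The sequence `∑ i, pᵢ f (· + i)`, for a polynomial `p = ∑ i, pᵢ X ^ i`. -/
noncomputable def shiftComb (p : ℝ[X]) (f : ℕ → ℝ) : ℕ → ℝ := Polynomial.aeval shiftEnd p f

lemma shiftEnd_apply (f : ℕ → ℝ) (n : ℕ) : shiftEnd f n = f (n + 1) := rfl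

lemma shiftEnd_pow_apply (f : ℕ → ℝ) (k n : ℕ) : (shiftEnd ^ k) f n = f (n + k) := by
  induction k generalizing n with
  | zero => rfl
  | succ k ih =>
    rw [pow_succ', Module.End.mul_apply, shiftEnd_apply, ih, add_right_comm, add_assoc]

lemma shiftComb_add_left (p q : ℝ[X]) (f : ℕ → ℝ) (n : ℕ) :
    shiftComb (p + q) f n = shiftComb p f n + shiftComb q f n := by simp [shiftComb]

lemma shiftComb_mul (p q : ℝ[X]) (f : ℕ → ℝ) :
    shiftComb (p * q) f = shiftComb p (shiftComb q f) := by
  simp [shiftComb, Module.End.mul_apply]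

lemma shiftComb_monomial (c : ℝ) (k : ℕ) (f : ℕ → ℝ) (n : ℕ) :
    shiftComb (Polynomial.monomial k c) f n = c * f (n + k) := by
  simp [shiftComb, Polynomial.aeval_monomial, Module.End.mul_apply, shiftEnd_pow_apply]

lemma shiftComb_C_mul (c : ℝ) (p : ℝ[X]) (f : ℕ → ℝ) (n : ℕ) :
    shiftComb (Polynomial.C c * p) f n = c * shiftComb p f n := by
  simp [shiftComb, Module.End.mul_apply]

lemma shiftComb_X_sub_one (f : ℕ → ℝ) :
    shiftComb (Polynomial.X - 1) f = fwdDiff (1 : ℕ) f := by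
  ext n; simp [shiftComb, shiftEnd_apply, fwdDiff]

lemma fwdDiff_iter_eq_shiftComb (k : ℕ) (f : ℕ → ℝ) :
    (fwdDiff (1 : ℕ))^[k] f = shiftComb ((Polynomial.X - 1) ^ k) f := by
  induction k with
  | zero => simp [shiftComb]
  | succ k ih => rw [Function.iterate_succ_apply', ih, pow_succ', shiftComb_mul, shiftComb_X_sub_one]

lemma fwdDiff_iter_shiftComb (k : ℕ) (p : ℝ[X]) (f : ℕ → ℝ) :
    (fwdDiff (1 : ℕ))^[k] (shiftComb p f) = shiftComb p ((fwdDiff (1 : ℕ))^[k] f) := by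
  rw [fwdDiff_iter_eq_shiftComb, fwdDiff_iter_eq_shiftComb, ← shiftComb_mul, mul_comm,
    shiftComb_mul]

lemma tendsto_shiftComb (p : ℝ[X]) {u : ℕ → ℝ} {c : ℝ} (hu : Tendsto u atTop (nhds c)) :
    Tendsto (shiftComb p u) atTop (nhds (p.eval 1 * c)) := by
  induction p using Polynomial.induction_on' with
  | add p q hp hq =>
    rw [Polynomial.eval_add, add_mul]
    exact (hp.add hq).congr fun n => (shiftComb_add_left p q u n).symm
  | monomial k a =>
    rw [Polynomial.eval_monomial, one_pow, mul_one]
    exact ((hu.comp (tendsto_add_atTop_nat k)).const_mul a).congr fun n =>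
      (shiftComb_monomial a k u n).symm

/-! ### Nonnegative combinations of characters, and kernels for Bohr sets. -/

/-- The submonoid of the sequences `cis ∘ shiftComb p f`. -/
noncomputable def charMonoid (f : ℕ → ℝ) : Submonoid (ℕ → ℂ) where
  carrier := Set.range fun (p : ℝ[X]) n => cis (shiftComb p f n)
  one_mem' := ⟨0, by ext n; simp [shiftComb]⟩
  mul_mem' := by
    rintro _ _ ⟨p, rfl⟩ ⟨q, rfl⟩
    exact ⟨p + q, by ext n; simp [shiftComb_add_left, cis_add]⟩

/-- The sequences that are combinations of sequences in `charMonoid f` with nonnegative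
coefficients. -/
noncomputable def charCone (f : ℕ → ℝ) : Subalgebra ℝ≥0 (ℕ → ℂ) :=
  Algebra.adjoin ℝ≥0 (charMonoid f : Set (ℕ → ℂ))

lemma cis_mem_charCone (f : ℕ → ℝ) (p : ℝ[X]) :
    (fun n => cis (shiftComb p f n)) ∈ charCone f :=
  Algebra.subset_adjoin ⟨p, rfl⟩

/-- Here `(1 + cos t) / 2 = |exp (i t) + 1|² / 4`; the binomial theorem makes all coefficients
nonnegative. -/
lemma half_one_add_cos_pow (m : ℕ) (t : ℝ) :
    ((((1 + Real.cos t) / 2) ^ m : ℝ) : ℂ) =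
      ∑ k ∈ Finset.range (2 * m + 1),
        ((((2 * m).choose k / 4 ^ m : ℝ)) : ℂ) * cis (((k : ℝ) - m) * t) := by
  have h1 : (((1 + Real.cos t) / 2 : ℝ) : ℂ) = cis (-t) * (cis t + 1) ^ 2 / 4 := by
    have h2 : cis (-t) * cis t = 1 := by rw [← cis_add]; simp
    have h3 : (2 * Real.cos t : ℂ) = cis t + cis (-t) := by
      simp [cis, Complex.cos]; ring
    push_cast at h3 ⊢
    linear_combination (1 / 4) * h3 - (1 / 4) * (cis t + 2) * h2
  have h4 : ∀ k : ℕ, ∀ s : ℝ, cis s ^ k = cis (k * s) := fun k s => by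
    simp [cis, ← Complex.exp_nat_mul, mul_assoc]
  rw [Complex.ofReal_pow, h1, div_pow, mul_pow, ← pow_mul, add_pow, h4, Finset.mul_sum,
    Finset.sum_div]
  refine Finset.sum_congr rfl fun k _ => ?_
  rw [h4, show ((k : ℝ) - m) * t = m * -t + k * t by ring, cis_add]
  push_cast
  ring

/-- The mean of `((1 + cos t) / 2) ^ m`. -/
noncomputable def kernelMean (m : ℕ) : ℝ≥0 := m.centralBinom / 4 ^ m

/-- The constant is the term `k = m` of the expansion, whose frequency vanishes. -/
lemma kernel_sub_mem_charCone (f : ℕ → ℝ) (p : ℝ[X]) (m : ℕ) :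
    ∃ b ∈ charCone f, ∀ n, ((((1 + Real.cos (shiftComb p f n)) / 2) ^ m : ℝ) : ℂ) =
      (kernelMean m : ℝ) + b n := by
  refine ⟨∑ k ∈ (Finset.range (2 * m + 1)).erase m, ((2 * m).choose k / 4 ^ m : ℝ≥0) •
    (fun n => cis (shiftComb (Polynomial.C ((k : ℝ) - m) * p) f n)),
    sum_mem fun k _ => Subalgebra.smul_mem _ (cis_mem_charCone f _) _, fun n => ?_⟩
  rw [half_one_add_cos_pow, ← Finset.add_sum_erase _ _ (show m ∈ Finset.range (2 * m + 1) by
    simp; omega)]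
  simp only [shiftComb_C_mul]
  simp [kernelMean, Nat.centralBinom, NNReal.smul_def]

lemma prod_kernel_sub_mem_charCone {ι : Type*} (s : Finset ι) (f : ℕ → ℝ) (p : ι → ℝ[X])
    (m : ℕ) :
    ∃ b ∈ charCone f, ∀ n,
      ((∏ i ∈ s, ((1 + Real.cos (shiftComb (p i) f n)) / 2) ^ m : ℝ) : ℂ) =
        ((kernelMean m ^ s.card : ℝ≥0) : ℝ) + b n := by
  classical
  induction s using Finset.induction_on with
  | empty => exact ⟨0, zero_mem _, by simp⟩
  | insert i s hi ih =>
    obtain ⟨b, hb, hb'⟩ := ih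
    obtain ⟨d, hd, hd'⟩ := kernel_sub_mem_charCone f (p i) m
    refine ⟨kernelMean m • b + kernelMean m ^ s.card • d + d * b,
      add_mem (add_mem (Subalgebra.smul_mem _ hb _) (Subalgebra.smul_mem _ hd _)) (mul_mem hd hb),
      fun n => ?_⟩
    rw [Finset.prod_insert hi, Complex.ofReal_mul, hb', hd', Finset.card_insert_of_notMem hi]
    simp only [Pi.add_apply, Pi.mul_apply, Pi.smul_apply, NNReal.smul_def, Complex.real_smul]
    push_cast
    ring

/-- The mean is at least `1 / (2m)`: its powers decay polynomially in `m`, against the exponential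
decay of `q ^ m`. -/
lemma exists_kernelMean_gt (D : ℕ) {q : ℝ} (hq0 : 0 < q) (hq1 : q < 1) :
    ∃ m : ℕ, 3 * q ^ m < (kernelMean m : ℝ) ^ D := by
  have h := (tendsto_pow_const_mul_const_pow_of_abs_lt_one D (r := q)
    (by rwa [abs_of_pos hq0])).const_mul (3 * 2 ^ D)
  rw [mul_zero] at h
  obtain ⟨m, hm, hm0⟩ := ((h.eventually (gt_mem_nhds one_pos)).and (eventually_gt_atTop 0)).exists
  refine ⟨m, ?_⟩
  have h1 : (1 : ℝ) / (2 * m) ≤ kernelMean m := by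
    have := Nat.four_pow_le_two_mul_self_mul_centralBinom m hm0
    have h2 : (4 : ℝ) ^ m ≤ 2 * m * m.centralBinom := by exact_mod_cast this
    simp only [kernelMean]
    push_cast
    rw [div_le_div_iff₀ (by positivity) (by positivity)]
    linarith
  refine lt_of_lt_of_le ?_ (pow_le_pow_left₀ (by positivity) h1 D)
  rw [one_div, inv_pow, mul_pow, ← one_div, lt_div_iff₀ (by positivity)]
  linarith

namespace IsWeight

variable {V : ℕ → ℝ} (hV : IsWeight V)
include hV

/-- The polynomial `p - p(1)` is divisible by `X - 1`, so on `V` it acts as a combination of shifts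
of `ΔV`, which tends to 0. -/
lemma tendsto_shiftComb_sub (p : ℝ[X]) :
    Tendsto (fun n => shiftComb p V n - p.eval 1 * V n) atTop (nhds 0) := by
  obtain ⟨q, hq⟩ := Polynomial.dvd_iff_isRoot.2
    (show (p - Polynomial.C (p.eval 1)).IsRoot 1 by simp)
  have h := tendsto_shiftComb q hV.lim
  rw [mul_zero, ← shiftComb_X_sub_one, ← shiftComb_mul, mul_comm, ← map_one Polynomial.C, ← hq] at h
  refine h.congr fun n => ?_
  simp [shiftComb]

lemma tendsto_wavg_cis_shiftComb {ℓ : ℕ} {f : ℕ → ℝ} {α c : ℝ} (hα : α ≠ 0)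
    (hf : Tendsto (fun n => (fwdDiff (1 : ℕ))^[ℓ] f n - α * V n) atTop (nhds c)) {p : ℝ[X]}
    (hp : p.eval 1 ≠ 0) :
    Tendsto (wavg V fun n => cis (shiftComb p f n)) (windows V) (nhds 0) := by
  refine hV.tendsto_wavg_cis (k := ℓ) (α := p.eval 1 * α) (mul_ne_zero hp hα)
    (((tendsto_shiftComb p hf).add ((hV.tendsto_shiftComb_sub p).const_mul α)).congr fun n => ?_)
  have h : (fun n => (fwdDiff (1 : ℕ))^[ℓ] f n - α * V n) =
      (fwdDiff (1 : ℕ))^[ℓ] f - α • V := rfl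
  rw [h, fwdDiff_iter_shiftComb]
  simp only [shiftComb, map_sub, map_smul, Pi.sub_apply, Pi.smul_apply, smul_eq_mul]
  ring

/-- Factors `X - 1` are moved from `p` to `f` as differences. Either a cofactor with nonzero value
at 1 appears at some stage and Weyl's criterion applies, or `f` is differenced `ℓ + 1` times and
tends to 0. -/
lemma shiftComb_dichotomy {ℓ : ℕ} {f : ℕ → ℝ} {α c : ℝ} (hα : α ≠ 0)
    (hf : Tendsto (fun n => (fwdDiff (1 : ℕ))^[ℓ] f n - α * V n) atTop (nhds c)) (p : ℝ[X]) :
    Tendsto (shiftComb p f) atTop (nhds 0) ∨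
      Tendsto (wavg V fun n => cis (shiftComb p f n)) (windows V) (nhds 0) := by
  induction ℓ generalizing f p with
  | zero =>
    by_cases hp : p.eval 1 = 0
    · obtain ⟨q, rfl⟩ := Polynomial.dvd_iff_isRoot.2 hp
      refine Or.inl ?_
      have h1 : Tendsto (fwdDiff (1 : ℕ) f) atTop (nhds 0) := by
        have h2 := ((hf.comp (tendsto_add_atTop_nat 1)).sub hf).add (hV.lim.const_mul α)
        rw [sub_self, mul_zero, add_zero] at h2
        refine h2.congr fun n => ?_
        simp only [Function.comp, Function.iterate_zero, id, fwdDiff]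
        ring
      rw [map_one, mul_comm, shiftComb_mul, shiftComb_X_sub_one]
      simpa using tendsto_shiftComb q h1
    · exact Or.inr (hV.tendsto_wavg_cis_shiftComb hα hf hp)
  | succ ℓ ih =>
    by_cases hp : p.eval 1 = 0
    · obtain ⟨q, rfl⟩ := Polynomial.dvd_iff_isRoot.2 hp
      rw [map_one, mul_comm, shiftComb_mul, shiftComb_X_sub_one]
      exact ih (f := fwdDiff (1 : ℕ) f) hf q
    · exact Or.inr (hV.tendsto_wavg_cis_shiftComb hα hf hp)

/-- By the dichotomy each generating character has mean 0 or 1, so nonnegative combinations have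
nonnegative means. -/
lemma exists_tendsto_of_mem_charCone {ℓ : ℕ} {f : ℕ → ℝ} {α c : ℝ} (hα : α ≠ 0)
    (hf : Tendsto (fun n => (fwdDiff (1 : ℕ))^[ℓ] f n - α * V n) atTop (nhds c)) {a : ℕ → ℂ}
    (ha : a ∈ charCone f) :
    ∃ x : ℝ≥0, Tendsto (wavg V a) (windows V) (nhds ((x : ℝ) : ℂ)) := by
  -- The characters form a monoid, so the algebra they generate is just their linear span over
  -- `ℝ≥0`.
  rw [charCone, ← Subalgebra.mem_toSubmodule, Algebra.adjoin_eq_span, Submonoid.closure_eq] at ha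
  induction ha using Submodule.span_induction with
  | mem a ha =>
    obtain ⟨p, rfl⟩ := ha
    rcases hV.shiftComb_dichotomy hα hf p with h | h
    · refine ⟨1, ?_⟩
      have h1 : Tendsto (fun n => cis (shiftComb p f n) - 1) atTop (nhds 0) := by
        have := ((continuous_cis.tendsto 0).comp h).sub_const 1
        simpa using this
      have h2 := (hV.tendsto_wavg_zero h1).add_const (1 : ℂ)
      rw [zero_add] at h2
      refine Tendsto.congr' ?_ (by simpa using h2)
      filter_upwards [hV.wavg_const 1] with p hp
      rw [wavg_sub, hp, sub_add_cancel]
    · exact ⟨0, by simpa using h⟩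
  | zero => exact ⟨0, by simpa using tendsto_const_nhds.congr fun p => by simp [wavg]⟩
  | add a b _ _ ha hb =>
    obtain ⟨x, hx⟩ := ha
    obtain ⟨y, hy⟩ := hb
    refine ⟨x + y, ?_⟩
    push_cast
    exact (hx.add hy).congr fun p => (wavg_add V a b p).symm
  | smul r a _ ha =>
    obtain ⟨x, hx⟩ := ha
    refine ⟨r * x, ?_⟩
    push_cast
    exact (hx.const_mul _).congr fun p => (wavg_const_mul V (r : ℝ) a p).symm

/-- A Bohr set of positive lower density, in the form of a kernel that is small off the set. -/
lemma exists_kernel {ℓ : ℕ} {f : ℕ → ℝ} {α c : ℝ} (hα : α ≠ 0)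
    (hf : Tendsto (fun n => (fwdDiff (1 : ℕ))^[ℓ] f n - α * V n) atTop (nhds c))
    {ι : Type*} (s : Finset ι) (p : ι → ℝ[X]) {η : ℝ} (hη : 0 < η) :
    ∃ κ > 0, ∃ K : ℕ → ℝ, (∀ n, K n ≤ 1) ∧
      (∀ n, κ < K n → ∀ i ∈ s, 1 - η < Real.cos (shiftComb (p i) f n)) ∧
      ∀ᶠ w in windows V, 2 * κ ≤ (wavg V (fun n => (K n : ℂ)) w).re := by
  -- `1 - η / 2` is the value of `(1 + cos) / 2` at `cos = 1 - η`; the minimum with 1 keeps `q`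
  -- positive. With `κ = q ^ m`, one bad cosine already forces `K n ≤ κ`.
  set q : ℝ := 1 - min η 1 / 2 with hq
  have hmin : 0 < min η 1 := lt_min hη one_pos
  have hmin1 : min η 1 ≤ 1 := min_le_right _ _
  obtain ⟨m, hm⟩ := exists_kernelMean_gt s.card (q := q) (by linarith) (by linarith)
  have hqm : 0 < q ^ m := pow_pos (by linarith) m
  have h01 : ∀ t : ℝ, 0 ≤ ((1 + Real.cos t) / 2) ^ m ∧ ((1 + Real.cos t) / 2) ^ m ≤ 1 := fun t => by
    have h1 := Real.neg_one_le_cos t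
    have h2 := Real.cos_le_one t
    exact ⟨pow_nonneg (by linarith) m, pow_le_one₀ (by linarith) (by linarith)⟩
  refine ⟨q ^ m, hqm, fun n => ∏ i ∈ s, ((1 + Real.cos (shiftComb (p i) f n)) / 2) ^ m,
    fun n => Finset.prod_le_one (fun i _ => (h01 _).1) fun i _ => (h01 _).2, fun n hn i hi => ?_, ?_⟩
  · by_contra! hcon
    refine hn.not_ge ?_
    classical
    beta_reduce
    rw [← Finset.mul_prod_erase _ _ hi]
    have h1 : ((1 + Real.cos (shiftComb (p i) f n)) / 2) ^ m ≤ q ^ m := by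
      refine pow_le_pow_left₀ (by linarith [Real.neg_one_le_cos (shiftComb (p i) f n)]) ?_ m
      have := min_le_left η 1
      linarith
    refine (mul_le_mul h1 (Finset.prod_le_one (fun i _ => (h01 _).1) fun i _ => (h01 _).2)
      (Finset.prod_nonneg fun i _ => (h01 _).1) hqm.le).trans_eq (mul_one _)
  · obtain ⟨b, hb, hb'⟩ := prod_kernel_sub_mem_charCone s f p m
    obtain ⟨x, hx⟩ := hV.exists_tendsto_of_mem_charCone hα hf hb
    have h1 := (Complex.continuous_re.tendsto _).comp hx
    rw [Complex.ofReal_re] at h1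
    -- The constant term exceeds `3 q ^ m`; passing from the limit `x ≥ 0` to finite windows loses
    -- `q ^ m`, leaving `2κ`.
    filter_upwards [h1.eventually (lt_mem_nhds (show (x : ℝ) - q ^ m < x by linarith)),
      hV.wavg_const ((kernelMean m ^ s.card : ℝ≥0) : ℝ)] with w hw1 hw2
    simp only [hb', wavg_add, hw2, Complex.add_re, Complex.ofReal_re]
    simp only [Function.comp] at hw1
    have := x.2
    push_cast
    have : (0 : ℝ) ≤ x := x.2
    linarith

end IsWeight

/-! ### Fourier transforms of measures: Wiener's lemma and the splitting off of atoms. -/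

/-- The Fourier transform `t ↦ ∫ exp (i t θ) dσ(θ)` of a measure on the line. -/
noncomputable def cisTransform (σ : Measure ℝ) (t : ℝ) : ℂ := ∫ θ, cis (t * θ) ∂σ

lemma continuous_cis_mul (t : ℝ) : Continuous fun θ : ℝ => cis (t * θ) :=
  continuous_cis.comp (by fun_prop)

lemma integrable_cis_mul (σ : Measure ℝ) [IsFiniteMeasure σ] (t : ℝ) :
    Integrable (fun θ : ℝ => cis (t * θ)) σ :=
  (integrable_const (1 : ℝ)).mono' (continuous_cis_mul t).aestronglyMeasurable
    (Eventually.of_forall fun _ => (norm_cis _).le)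

lemma norm_cisTransform_sq (σ : Measure ℝ) [IsFiniteMeasure σ] (t : ℝ) :
    ((‖cisTransform σ t‖ ^ 2 : ℝ) : ℂ) = ∫ z : ℝ × ℝ, cis ((z.1 - z.2) * t) ∂(σ.prod σ) := by
  have h1 : ((‖cisTransform σ t‖ ^ 2 : ℝ) : ℂ) =
      cisTransform σ t * (starRingEnd ℂ) (cisTransform σ t) := by
    rw [Complex.mul_conj, Complex.normSq_eq_norm_sq]
  rw [h1, cisTransform, ← integral_conj, ← integral_prod_mul]
  congr 1 with z
  rw [conj_cis, ← cis_add]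
  ring_nf

lemma norm_cisTransform_sub_le (σ : Measure ℝ) [IsFiniteMeasure σ] {B : ℝ}
    (hσ : ∀ᵐ θ ∂σ, |θ| ≤ B) (s t : ℝ) :
    ‖cisTransform σ s - cisTransform σ t‖ ≤ |s - t| * B * σ.real Set.univ := by
  rw [cisTransform, cisTransform, ← integral_sub (integrable_cis_mul σ s) (integrable_cis_mul σ t)]
  refine norm_integral_le_of_norm_le_const (hσ.mono fun θ hθ => ?_)
  refine (norm_cis_sub_cis_le _ _).trans ?_
  rw [← sub_mul, abs_mul]
  exact mul_le_mul_of_nonneg_left hθ (abs_nonneg _)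

/-- **Wiener's lemma** along `f`. -/
lemma IsWeight.tendsto_wavg_norm_cisTransform_sq {V : ℕ → ℝ} (hV : IsWeight V) {ℓ : ℕ} {f : ℕ → ℝ}
    {α c : ℝ} (hα : α ≠ 0)
    (hf : Tendsto (fun n => (fwdDiff (1 : ℕ))^[ℓ] f n - α * V n) atTop (nhds c))
    (σ : Measure ℝ) [IsFiniteMeasure σ] [NullSingletonClass σ] (h : ℕ) :
    Tendsto (wavg V fun n => ((‖cisTransform σ (f (n + h))‖ ^ 2 : ℝ) : ℂ)) (windows V)
      (nhds 0) := by
  have hmeas : ∀ t : ℝ, Continuous fun z : ℝ × ℝ => cis ((z.1 - z.2) * t) := fun t =>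
    continuous_cis.comp (by fun_prop)
  have hint : ∀ t : ℝ, Integrable (fun z : ℝ × ℝ => cis ((z.1 - z.2) * t)) (σ.prod σ) := fun t =>
    (integrable_const (1 : ℝ)).mono' (hmeas t).aestronglyMeasurable
      (Eventually.of_forall fun θ => (norm_cis _).le)
  have h1 : ∀ p, ∫ z : ℝ × ℝ, wavg V (fun n => cis ((z.1 - z.2) * f (n + h))) p ∂(σ.prod σ) =
      wavg V (fun n => ((‖cisTransform σ (f (n + h))‖ ^ 2 : ℝ) : ℂ)) p := fun p => by
    simp only [wavg, norm_cisTransform_sq]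
    rw [integral_div, integral_finsetSum _ fun n _ => (hint _).const_mul _]
    simp only [integral_const_mul]
  -- Atomlessness enters here: the diagonal is null, and off it the frequency `z.1 - z.2` is
  -- nonzero, so Weyl's criterion applies.
  have hdiag : ∀ᵐ z : ℝ × ℝ ∂(σ.prod σ), z.1 ≠ z.2 := by
    have hm : MeasurableSet {z : ℝ × ℝ | z.1 = z.2} := isClosed_diagonal.measurableSet
    rw [ae_iff]
    simp only [ne_eq, not_not]
    rw [Measure.measure_prod_null hm]
    refine Eventually.of_forall fun x => ?_
    have : Prod.mk x ⁻¹' {z : ℝ × ℝ | z.1 = z.2} = {x} := by ext y; simp [eq_comm]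
    simp [this]
  have h2 : Tendsto (fun p => ∫ z : ℝ × ℝ, wavg V (fun n => cis ((z.1 - z.2) * f (n + h))) p
      ∂(σ.prod σ)) (windows V) (nhds (∫ _z : ℝ × ℝ, (0 : ℂ) ∂(σ.prod σ))) := by
    refine tendsto_integral_filter_of_dominated_convergence (fun _ => 1) ?_ ?_
      (integrable_const _) ?_
    · refine Eventually.of_forall fun p => Continuous.aestronglyMeasurable ?_
      unfold wavg
      have := hmeas
      fun_prop
    · filter_upwards [IsWeight.eventually_gt (V := V) 0, hV.eventually_le] with p hp hle
      exact Eventually.of_forall fun z =>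
        hV.norm_wavg_le_of_lt (fun n => (norm_cis _).le) hp hle
    · filter_upwards [hdiag] with z hz
      have := hV.tendsto_wavg_cis_shiftComb hα hf (p := Polynomial.monomial h (z.1 - z.2))
        (by simpa [sub_eq_zero] using hz)
      simpa only [shiftComb_monomial] using this
  rw [integral_zero] at h2
  exact h2.congr h1

lemma exists_finset_measure_diff_lt {X : Type*} [MeasurableSpace X] [MeasurableSingletonClass X]
    (σ : Measure X) [IsFiniteMeasure σ] {D : Set X} (hD : D.Countable) {ε : ℝ} (hε : 0 < ε) :
    ∃ F : Finset X, (F : Set X) ⊆ D ∧ σ.real (D \ F) < ε := by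
  classical
  rcases D.eq_empty_or_nonempty with rfl | hne
  · exact ⟨∅, by simp, by simpa using hε⟩
  obtain ⟨u, rfl⟩ := hD.exists_eq_range hne
  let F : ℕ → Finset X := fun n => (Finset.range n).image u
  have hlim : Tendsto (fun n => σ (Set.range u \ F n)) atTop
      (nhds (σ (⋂ n, Set.range u \ F n))) := by
    refine tendsto_measure_iInter_atTop (fun n => ?_) (fun m n hmn => ?_) ⟨0, by finiteness⟩
    · exact ((Set.countable_range u).mono Set.sdiff_subset).measurableSet.nullMeasurableSet
    · refine Set.sdiff_subset_sdiff_right ?_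
      exact_mod_cast Finset.image_subset_image (Finset.range_mono hmn)
  have hemp : ⋂ n, Set.range u \ F n = ∅ := by
    refine Set.eq_empty_of_forall_notMem fun x hx => ?_
    rw [Set.mem_iInter] at hx
    obtain ⟨k, rfl⟩ := (hx 0).1
    exact (hx (k + 1)).2 (by simpa [F] using ⟨k, le_rfl, rfl⟩)
  rw [hemp, measure_empty] at hlim
  obtain ⟨n, hn⟩ := (hlim.eventually (gt_mem_nhds (ENNReal.ofReal_pos.2 hε))).exists
  refine ⟨F n, fun x hx => ?_, ?_⟩
  · simp only [F, Finset.coe_image] at hx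
    exact Set.image_subset_range _ _ hx
  · rwa [Measure.real, ← ENNReal.lt_ofReal_iff_toReal_lt (by finiteness)]

/-- Splitting a finite measure on the line into finitely many atoms, a measure without atoms and a
small error. -/
lemma exists_atoms_add_noAtoms (σ : Measure ℝ) [IsFiniteMeasure σ] {ε : ℝ} (hε : 0 < ε) :
    ∃ (F : Finset ℝ) (τ : Measure ℝ), τ ≤ σ ∧ NullSingletonClass τ ∧ (∀ θ ∈ F, σ {θ} ≠ 0) ∧
      ∀ t, ∑ θ ∈ F, σ.real {θ} * Real.cos (t * θ) - ‖cisTransform τ t‖ - ε ≤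
        (cisTransform σ t).re := by
  -- `D` is the set of atoms of `σ`.
  set D : Set ℝ := {t | 0 < σ {a | id a = t}} with hDdef
  have hD : D.Countable := Measure.countable_meas_level_set_pos measurable_id
  have hDm := hD.measurableSet
  have hmem : ∀ x, x ∈ D ↔ σ {x} ≠ 0 := fun x => by simp [hDdef, pos_iff_ne_zero]
  obtain ⟨F, hFD, hF⟩ := exists_finset_measure_diff_lt σ hD hε
  have hFm : MeasurableSet (F : Set ℝ) := F.measurableSet
  refine ⟨F, σ.restrict Dᶜ, Measure.restrict_le_self, ⟨fun x => ?_⟩, fun θ hθ => (hmem θ).1 (hFD hθ),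
    fun t => ?_⟩
  · rw [Measure.restrict_apply (measurableSet_singleton x)]
    by_cases hx : σ {x} = 0
    · exact measure_mono_null Set.inter_subset_left hx
    · have : ({x} : Set ℝ) ∩ Dᶜ = ∅ := by
        ext y; simp only [Set.mem_inter_iff, Set.mem_singleton_iff, Set.mem_compl_iff,
          Set.mem_empty_iff_false, iff_false, not_and, not_not]
        rintro rfl; exact (hmem y).2 hx
      rw [this, measure_empty]
  · have hi := integrable_cis_mul σ t
    have h1 : cisTransform σ t = ∫ θ in (F : Set ℝ), cis (t * θ) ∂σ +
        ∫ θ in D \ F, cis (t * θ) ∂σ + cisTransform (σ.restrict Dᶜ) t := by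
      rw [cisTransform, cisTransform, ← integral_add_compl hDm hi,
        ← setIntegral_union Set.disjoint_sdiff_right (hDm.diff hFm) hi.integrableOn hi.integrableOn,
        Set.union_sdiff_cancel hFD]
    have h2 : (∫ θ in (F : Set ℝ), cis (t * θ) ∂σ).re =
        ∑ θ ∈ F, σ.real {θ} * Real.cos (t * θ) := by
      rw [setIntegral_finset _ hi.integrableOn]
      simp [cis_re]
    have h3 : ‖∫ θ in D \ F, cis (t * θ) ∂σ‖ ≤ ε := by
      refine (norm_setIntegral_le_of_norm_le_const (C := 1) (by finiteness)
        fun θ _ => (norm_cis _).le).trans ?_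
      rw [one_mul]; exact hF.le
    rw [h1, Complex.add_re, Complex.add_re, h2]
    have h4 := (abs_le.1 ((Complex.abs_re_le_norm _).trans h3)).1
    have h5 := (abs_le.1 (Complex.abs_re_le_norm (cisTransform (σ.restrict Dᶜ) t))).1
    linarith

/-! ### Herglotz' theorem. -/

lemma integral_cis_int_mul (m : ℤ) :
    ∫ θ in Set.Icc 0 (2 * Real.pi), cis (m * θ) = if m = 0 then ((2 * Real.pi : ℝ) : ℂ) else 0 := by
  rw [integral_Icc_eq_integral_Ioc, ← intervalIntegral.integral_of_le (by positivity)]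
  split_ifs with h
  · simp [h]
  · have hc : (m * Complex.I : ℂ) ≠ 0 := by simp [h]
    have := integral_exp_mul_complex (a := 0) (b := 2 * Real.pi) hc
    simp only [cis]
    calc ∫ θ in (0 : ℝ)..(2 * Real.pi), Complex.exp (((m * θ : ℝ) : ℂ) * Complex.I)
        = ∫ θ in (0 : ℝ)..(2 * Real.pi), Complex.exp (m * Complex.I * θ) := by
          congr 1; ext θ; push_cast; ring_nf
      _ = 0 := by
          rw [this]
          have h1 : Complex.exp (m * Complex.I * ((2 * Real.pi : ℝ) : ℂ)) = 1 := by
            rw [Complex.exp_eq_one_iff]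
            exact ⟨m, by push_cast; ring⟩
          rw [h1]; simp

/-- A function on `ℤ` is positive definite. -/
def IsPosDef (v : ℤ → ℝ) : Prop :=
  (∀ k, v (-k) = v k) ∧ ∀ (N : ℕ) (c : ℕ → ℂ), 0 ≤ (∑ j ∈ Finset.range N, ∑ k ∈ Finset.range N,
    c j * (starRingEnd ℂ) (c k) * v ((j : ℤ) - k)).re

/-- The Fejér sums of `v`. -/
noncomputable def fejerSum (v : ℤ → ℝ) (N : ℕ) (θ : ℝ) : ℂ :=
  ∑ j ∈ Finset.range N, ∑ k ∈ Finset.range N, (v ((j : ℤ) - k) : ℂ) *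
    cis ((((k : ℤ) - j : ℤ) : ℝ) * θ)

lemma continuous_fejerSum (v : ℤ → ℝ) (N : ℕ) : Continuous (fejerSum v N) := by
  unfold fejerSum
  have := fun t => continuous_cis_mul t
  fun_prop

namespace IsPosDef

variable {v : ℤ → ℝ} (hv : IsPosDef v)
include hv

/-- This is positive definiteness for the coefficients `c j = exp (-i j θ)`. -/
lemma fejerSum_re_nonneg (N : ℕ) (θ : ℝ) : 0 ≤ (fejerSum v N θ).re := by
  refine (hv.2 N fun j => cis (-(j * θ))).trans_eq ?_
  rw [fejerSum]
  congr 1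
  refine Finset.sum_congr rfl fun j _ => Finset.sum_congr rfl fun k _ => ?_
  rw [conj_cis, ← cis_add, mul_comm]
  congr 2
  push_cast; ring

lemma ofReal_fejerSum_re (N : ℕ) (θ : ℝ) : ((fejerSum v N θ).re : ℂ) = fejerSum v N θ := by
  rw [← Complex.conj_eq_iff_re, fejerSum, map_sum, Finset.sum_comm]
  simp only [map_sum, map_mul, Complex.conj_ofReal, conj_cis]
  refine Finset.sum_congr rfl fun j _ => Finset.sum_congr rfl fun k _ => ?_
  rw [← hv.1 ((j : ℤ) - k)]
  congr 2
  · rw [neg_sub]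
  · push_cast; ring

omit hv in
-- By orthogonality only the pairs with `j - k = m` survive; there are `N - m` of them, none when `m
-- ≥ N`, in accordance with truncated subtraction.
lemma integral_cis_mul_fejerSum (m N : ℕ) :
    ∫ θ in Set.Icc 0 (2 * Real.pi), cis (m * θ) * fejerSum v N θ =
      2 * Real.pi * ((N - m : ℕ) * v m) := by
  have h1 : ∀ θ : ℝ, cis (m * θ) * fejerSum v N θ =
      ∑ j ∈ Finset.range N, ∑ k ∈ Finset.range N, (v ((j : ℤ) - k) : ℂ) *
        cis (((m + k - j : ℤ) : ℝ) * θ) := fun θ => by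
    rw [fejerSum, Finset.mul_sum]
    refine Finset.sum_congr rfl fun j _ => ?_
    rw [Finset.mul_sum]
    refine Finset.sum_congr rfl fun k _ => ?_
    rw [mul_left_comm, ← cis_add]
    congr 2
    push_cast; ring
  have hi : ∀ t : ℝ, Integrable (fun θ => cis (t * θ))
      (volume.restrict (Set.Icc 0 (2 * Real.pi))) := fun t => integrable_cis_mul _ t
  simp only [h1]
  rw [integral_finsetSum _ fun j _ => integrable_finsetSum _ fun k _ => (hi _).const_mul _]
  simp only [integral_finsetSum _ fun k _ => (hi _).const_mul _, integral_const_mul,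
    integral_cis_int_mul]
  rw [Finset.sum_comm]
  have h2 : ∀ k ∈ Finset.range N, (∑ j ∈ Finset.range N, (v ((j : ℤ) - k) : ℂ) *
      if (m + k - j : ℤ) = 0 then ((2 * Real.pi : ℝ) : ℂ) else 0) =
      if k ∈ Finset.range (N - m) then (v m : ℂ) * (2 * Real.pi : ℝ) else 0 := fun k _ => by
    split_ifs with hk
    · rw [Finset.mem_range] at hk
      rw [Finset.sum_eq_single_of_mem (m + k) (by simp; omega) fun j _ hj => by
        rw [if_neg (by omega), mul_zero]]
      simp
    · rw [Finset.mem_range] at hk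
      refine Finset.sum_eq_zero fun j hj => ?_
      rw [Finset.mem_range] at hj
      rw [if_neg (by omega), mul_zero]
  rw [Finset.sum_congr rfl h2, Finset.sum_ite_mem, Finset.inter_eq_right.2
    (Finset.range_mono (by omega)), Finset.sum_const, Finset.card_range]
  simp
  ring

/-- **Herglotz' theorem**. -/
theorem exists_measure : ∃ σ : Measure ℝ, IsFiniteMeasure σ ∧ σ (Set.Icc 0 (2 * Real.pi))ᶜ = 0 ∧
    ∀ k : ℤ, cisTransform σ k = v k := by
  set I := Set.Icc 0 (2 * Real.pi) with hI
  let d : ℕ → ℝ → ℝ≥0 := fun N θ => Real.toNNReal ((fejerSum v N θ).re / (2 * Real.pi * N))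
  have hdc : ∀ N, Continuous (d N) := fun N => by
    have := continuous_fejerSum v N
    fun_prop
  have hd : ∀ N θ, ((d N θ : ℝ) : ℂ) = fejerSum v N θ / (2 * Real.pi * N) := fun N θ => by
    rw [Real.coe_toNNReal _ (div_nonneg (hv.fejerSum_re_nonneg N θ) (by positivity))]
    push_cast
    rw [hv.ofReal_fejerSum_re]
  -- The normalised Fejér densities have `m`-th coefficient `(1 - m / N) v m` for `N ≥ m`, `N > 0`;
  -- `σ` will be a weak limit of them.
  let ν : ℕ → Measure ℝ := fun N => (volume.restrict I).withDensity fun θ => d N θ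
  have hν : ∀ m N, cisTransform (ν N) (m : ℕ) = ((N - m : ℕ) / N : ℝ) * v m := fun m N => by
    rw [cisTransform, integral_withDensity_eq_integral_smul (hdc N).measurable]
    have h1 : ∀ θ : ℝ, d N θ • cis (m * θ) =
        cis (m * θ) * fejerSum v N θ / (2 * Real.pi * N) := fun θ => by
      rw [NNReal.smul_def, Complex.real_smul, hd]; ring
    simp only [h1]
    rw [integral_div, integral_cis_mul_fejerSum]
    have : (Real.pi : ℂ) ≠ 0 := by exact_mod_cast Real.pi_ne_zero
    rcases N.eq_zero_or_pos with rfl | hN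
    · simp
    · have : (N : ℂ) ≠ 0 := by exact_mod_cast hN.ne'
      push_cast
      field_simp
  have hfin : ∀ N, IsFiniteMeasure (ν N) := fun N => by
    have h1 : IntegrableOn (fun θ => (d N θ : ℝ)) I volume :=
      (NNReal.continuous_coe.comp (hdc N)).continuousOn.integrableOn_compact isCompact_Icc
    have := isFiniteMeasure_withDensity_ofReal h1.2
    simpa [ν] using this
  have hmass : ∀ N, (ν N).real Set.univ ≤ v 0 := fun N => by
    have h1 := hν 0 N
    have h2 : cisTransform (ν N) (0 : ℕ) = ((ν N).real Set.univ : ℂ) := by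
      simp [cisTransform]
    rw [h2] at h1
    have h3 : (ν N).real Set.univ = ((N : ℝ) / N) * v 0 := by exact_mod_cast h1
    have h0 : 0 ≤ v 0 := by simpa using hv.2 1 fun _ => 1
    rw [h3]
    exact mul_le_of_le_one_left h0 (div_self_le_one _)
  let μs : ℕ → FiniteMeasure ℝ := fun N => ⟨ν N, hfin N⟩
  have hcomp := isCompact_setOfPred_finiteMeasure_le_of_isCompact (E := ℝ) (v 0).toNNReal
    (isCompact_Icc (a := 0) (b := 2 * Real.pi))
  -- Measures of bounded mass on a compact interval form a compact set; a limit along an ultrafilter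
  -- replaces the choice of a subsequence.
  obtain ⟨σ, ⟨-, hσ⟩, hlim⟩ := hcomp.ultrafilter_le_nhds' ((hyperfilter ℕ).map μs) (by
    refine Filter.mem_map.2 (univ_mem' fun N => ⟨?_, ?_⟩)
    · rw [← NNReal.coe_le_coe]
      exact (hmass N).trans (Real.le_coe_toNNReal _)
    · rw [FiniteMeasure.null_iff_toMeasure_null]
      change ν N Iᶜ = 0
      have h0 : volume.restrict I Iᶜ = 0 := by
        rw [Measure.restrict_apply measurableSet_Icc.compl, Set.compl_inter_self, measure_empty]
      exact withDensity_absolutelyContinuous _ _ h0)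
  have hlim' : Tendsto μs (hyperfilter ℕ) (nhds σ) := hlim
  rw [FiniteMeasure.tendsto_iff_forall_integral_rclike_tendsto ℂ] at hlim'
  have hnat : ∀ m : ℕ, cisTransform σ m = v m := fun m => by
    have h1 := hlim' (BoundedContinuousFunction.ofNormedAddCommGroup (fun θ : ℝ => cis (m * θ))
      (continuous_cis_mul m) 1 fun θ => (norm_cis _).le)
    have h2 : Tendsto (fun N : ℕ => (((N - m : ℕ) / N : ℝ) : ℂ) * v m) (hyperfilter ℕ)
        (nhds ((1 : ℝ) * v m)) := by
      have h3 : Tendsto (fun N : ℕ => ((N - m : ℕ) / N : ℝ)) atTop (nhds 1) := by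
        have h4 : Tendsto (fun N : ℕ => 1 - (m : ℝ) / N) atTop (nhds (1 - 0)) :=
          tendsto_const_nhds.sub (tendsto_const_nhds.div_atTop tendsto_natCast_atTop_atTop)
        rw [sub_zero] at h4
        refine h4.congr' ?_
        filter_upwards [eventually_ge_atTop m, eventually_gt_atTop 0] with N hN hN0
        have : (N : ℝ) ≠ 0 := by exact_mod_cast hN0.ne'
        rw [Nat.cast_sub hN]; field_simp
      exact (((Complex.continuous_ofReal.tendsto _).comp h3).mul_const _).mono_left
        Nat.hyperfilter_le_atTop
    rw [Complex.ofReal_one, one_mul] at h2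
    refine tendsto_nhds_unique (h1.congr fun N => ?_) h2
    exact hν m N
  refine ⟨σ, inferInstance, ?_, fun k => ?_⟩
  · rwa [FiniteMeasure.null_iff_toMeasure_null] at hσ
  · obtain ⟨m, rfl | rfl⟩ := k.eq_nat_or_neg
    · exact_mod_cast hnat m
    · have h1 := congrArg (starRingEnd ℂ) (hnat m)
      rw [Complex.conj_ofReal, cisTransform, ← integral_conj] at h1
      rw [hv.1, ← h1, cisTransform]
      simp [conj_cis]

end IsPosDef

/-! ### Positive definiteness of the correlations. -/

section Recurrence

variable {X : Type*} [MeasurableSpace X] {μ : Measure X} {T : X ≃ᵐ X}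

lemma measurePreserving_zpow (hT : MeasurePreserving T μ μ) (k : ℤ) :
    MeasurePreserving ⇑((T.toEquiv : Equiv.Perm X) ^ k) μ μ := by
  have hnat : ∀ (S : X ≃ᵐ X), MeasurePreserving S μ μ → ∀ n : ℕ,
      MeasurePreserving ⇑((S.toEquiv : Equiv.Perm X) ^ n) μ μ := fun S hS n => by
    rw [Equiv.Perm.coe_pow]
    exact hS.iterate n
  obtain ⟨n, rfl | rfl⟩ := k.eq_nat_or_neg
  · simpa using hnat T hT n
  · have h := hnat T.symm hT.symm n
    rwa [zpow_neg, zpow_natCast, ← inv_pow]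

/-- The centred correlations `μ(A ∩ T^{-k} A) - μ(A)²`. -/
noncomputable def correlation (μ : Measure X) (T : X ≃ᵐ X) (A : Set X) (k : ℤ) : ℝ :=
  μ.real (A ∩ ⇑((T.toEquiv : Equiv.Perm X) ^ k) ⁻¹' A) - μ.real A ^ 2

lemma measureReal_inter_preimage (hT : MeasurePreserving T μ μ) {A : Set X} (hA : MeasurableSet A)
    (j k : ℤ) :
    μ.real (A ∩ ⇑((T.toEquiv : Equiv.Perm X) ^ (j - k)) ⁻¹' A) =
      μ.real (⇑((T.toEquiv : Equiv.Perm X) ^ k) ⁻¹' A ∩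
        ⇑((T.toEquiv : Equiv.Perm X) ^ j) ⁻¹' A) := by
  have hm := hA.inter ((measurePreserving_zpow hT (j - k)).measurable hA)
  rw [Measure.real, Measure.real,
    ← (measurePreserving_zpow hT k).measure_preimage hm.nullMeasurableSet, Set.preimage_inter,
    ← Set.preimage_comp, ← Equiv.Perm.coe_mul, ← zpow_add, sub_add_cancel]

/-- The value at `j - k` is the inner product of the centred indicators `ψ j` and `ψ k` of `T^{-j}
A` and `T^{-k} A`, so the quadratic form is the integral of a squared modulus. -/
lemma isPosDef_correlation [IsProbabilityMeasure μ] (hT : MeasurePreserving T μ μ) {A : Set X}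
    (hA : MeasurableSet A) : IsPosDef (correlation μ T A) := by
  refine ⟨fun k => ?_, fun N c => ?_⟩
  · have h := measureReal_inter_preimage hT hA 0 k
    rw [zero_sub, zpow_zero, Equiv.Perm.coe_one, Set.preimage_id, Set.inter_comm _ A] at h
    rw [correlation, h, correlation]
  · set B : ℕ → Set X := fun j => ⇑((T.toEquiv : Equiv.Perm X) ^ (j : ℤ)) ⁻¹' A with hB
    have hBm : ∀ j, MeasurableSet (B j) := fun j => (measurePreserving_zpow hT j).measurable hA
    have hBμ : ∀ j, μ.real (B j) = μ.real A := fun j => by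
      rw [Measure.real, Measure.real,
        (measurePreserving_zpow hT j).measure_preimage hA.nullMeasurableSet]
    let ψ : ℕ → X → ℝ := fun j x => (B j).indicator 1 x - μ.real A
    have hi : ∀ {s : Set X}, MeasurableSet s → Integrable (s.indicator (1 : X → ℝ)) μ := fun hs =>
      (integrable_const (1 : ℝ)).indicator hs
    have hexp : ∀ j k x, ψ j x * ψ k x = (B k ∩ B j).indicator 1 x -
        μ.real A * (B j).indicator 1 x - μ.real A * (B k).indicator 1 x + μ.real A ^ 2 :=
      fun j k x => by
        simp only [ψ]
        by_cases h1 : x ∈ B j <;> by_cases h2 : x ∈ B k <;> simp [h1, h2] <;> ring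
    have e1 : ∀ j k, Integrable (fun x => (B k ∩ B j).indicator (1 : X → ℝ) x) μ := fun j k =>
      hi ((hBm k).inter (hBm j))
    have e2 : ∀ j, Integrable (fun x => μ.real A * (B j).indicator (1 : X → ℝ) x) μ := fun j =>
      (hi (hBm j)).const_mul _
    have e3 : ∀ j k, Integrable (fun x => (B k ∩ B j).indicator (1 : X → ℝ) x -
        μ.real A * (B j).indicator (1 : X → ℝ) x) μ := fun j k => (e1 j k).sub (e2 j)
    have e4 : ∀ j k, Integrable (fun x => (B k ∩ B j).indicator (1 : X → ℝ) x -
        μ.real A * (B j).indicator (1 : X → ℝ) x - μ.real A * (B k).indicator (1 : X → ℝ) x) μ :=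
      fun j k => (e3 j k).sub (e2 k)
    have hint : ∀ j k, Integrable (fun x => ψ j x * ψ k x) μ := fun j k => by
      simp only [hexp]
      exact (e4 j k).add (integrable_const _)
    have hcorr : ∀ j k : ℕ, correlation μ T A ((j : ℤ) - k) = ∫ x, ψ j x * ψ k x ∂μ := fun j k => by
      simp only [hexp]
      rw [integral_add (e4 j k) (integrable_const _), integral_sub (e3 j k) (e2 k),
        integral_sub (e1 j k) (e2 j),
        integral_const_mul, integral_const_mul, integral_indicator_one ((hBm k).inter (hBm j)),
        integral_indicator_one (hBm j), integral_indicator_one (hBm k), hBμ, hBμ, correlation,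
        measureReal_inter_preimage hT hA]
      simp only [hB, integral_const, probReal_univ, one_smul]
      ring
    have hsum : ∀ x, ∑ j ∈ Finset.range N, ∑ k ∈ Finset.range N,
        c j * (starRingEnd ℂ) (c k) * ((ψ j x * ψ k x : ℝ) : ℂ) =
        ((‖∑ j ∈ Finset.range N, c j * ψ j x‖ ^ 2 : ℝ) : ℂ) := fun x => by
      have h1 : ∀ z : ℂ, ((‖z‖ ^ 2 : ℝ) : ℂ) = z * (starRingEnd ℂ) z := fun z => by
        rw [Complex.mul_conj, Complex.normSq_eq_norm_sq]
      rw [h1, map_sum, Finset.sum_mul_sum]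
      refine Finset.sum_congr rfl fun j _ => Finset.sum_congr rfl fun k _ => ?_
      rw [map_mul, Complex.conj_ofReal]
      push_cast; ring
    have hi' : ∀ j k, Integrable
        (fun x => c j * (starRingEnd ℂ) (c k) * ((ψ j x * ψ k x : ℝ) : ℂ)) μ :=
      fun j k => (hint j k).ofReal.const_mul _
    have h2 : ∑ j ∈ Finset.range N, ∑ k ∈ Finset.range N,
        c j * (starRingEnd ℂ) (c k) * (correlation μ T A ((j : ℤ) - k) : ℂ) =
        ((∫ x, ‖∑ j ∈ Finset.range N, c j * ψ j x‖ ^ 2 ∂μ : ℝ) : ℂ) := by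
      rw [← integral_complex_ofReal]
      simp only [← hsum]
      rw [integral_finsetSum _ fun j _ => integrable_finsetSum _ fun k _ => hi' j k]
      refine Finset.sum_congr rfl fun j _ => ?_
      rw [integral_finsetSum _ fun k _ => hi' j k]
      refine Finset.sum_congr rfl fun k _ => ?_
      rw [integral_const_mul, hcorr]
      congr 1
      exact integral_complex_ofReal.symm
    rw [h2, Complex.ofReal_re]
    exact integral_nonneg fun x => sq_nonneg _

end Recurrence

/-! ### Positive density of the good times. -/

/-- For `|y| ≤ 1/2` one has `cos (2πy) ≤ 1 - 8y²`, applied to the signed distance to the nearest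
integer. -/
lemma exists_int_abs_sub_lt {δ : ℝ} (hδ : 0 < δ) {x : ℝ}
    (hx : 1 - 8 * δ ^ 2 < Real.cos (2 * Real.pi * x)) : ∃ m : ℤ, |x - m| < δ := by
  refine ⟨round x, ?_⟩
  set y := x - round x with hy
  have h1 : |y| ≤ 1 / 2 := abs_sub_round x
  have h2 : Real.cos (2 * Real.pi * x) = Real.cos (2 * Real.pi * y) := by
    rw [hy, mul_sub, mul_comm (2 * Real.pi) (round x : ℝ), Real.cos_sub_int_mul_two_pi]
  have h3 : |2 * Real.pi * y| ≤ Real.pi := by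
    rw [abs_mul, abs_of_pos (by positivity)]
    nlinarith [Real.pi_pos]
  have h4 := Real.cos_le_one_sub_mul_cos_sq h3
  rw [← h2] at h4
  have h5 : 2 / Real.pi ^ 2 * (2 * Real.pi * y) ^ 2 = 8 * y ^ 2 := by
    field_simp; ring
  rw [h5] at h4
  exact abs_lt_of_sq_lt_sq (by linarith) hδ.le

lemma exists_tendsto_fwdDiff_iter_sub_const {V f : ℕ → ℝ} {ℓ : ℕ} {α c : ℝ}
    (hf : Tendsto (fun n => (fwdDiff (1 : ℕ))^[ℓ] f n - α * V n) atTop (nhds c)) (δ : ℝ) :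
    ∃ c', Tendsto (fun n => (fwdDiff (1 : ℕ))^[ℓ] (fun n => f n - δ) n - α * V n) atTop
      (nhds c') := by
  cases ℓ with
  | zero =>
    refine ⟨c - δ, (hf.sub_const δ).congr fun n => ?_⟩
    simp only [Function.iterate_zero, id]
    ring
  | succ ℓ =>
    refine ⟨c, hf.congr fun n => ?_⟩
    have : fwdDiff (1 : ℕ) (fun n => f n - δ) = fwdDiff (1 : ℕ) f := by
      ext n; simp [fwdDiff]
    rw [Function.iterate_succ_apply, Function.iterate_succ_apply, this]

/-- If `t` lies slightly to the right of an integer and `exp (i t θ)` is close to `1` for the atoms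
`θ` of `σ`, then the Fourier coefficient of `σ` at `⌊t⌋` is almost nonnegative. -/
lemma neg_lt_of_bohr {σ τ : Measure ℝ} [IsFiniteMeasure σ] [IsFiniteMeasure τ] {F : Finset ℝ}
    {ε δ t : ℝ} (hFI : ∀ θ ∈ F, |θ| ≤ 2 * Real.pi) (hτ : ∀ᵐ θ ∂τ, |θ| ≤ 2 * Real.pi)
    (hdec : ∀ t, ∑ θ ∈ F, σ.real {θ} * Real.cos (t * θ) - ‖cisTransform τ t‖ - ε / 4 ≤
        (cisTransform σ t).re) (hδ : 0 < δ) (hδ1 : δ ≤ 1 / 100)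
    (hδ2 : 2 * δ * (2 * Real.pi) * τ.real Set.univ ≤ ε / 4) (hε : 0 < ε)
    (hcos : ∀ θ ∈ insert (2 * Real.pi) F, 1 - 8 * δ ^ 2 < Real.cos (θ * (t - δ)))
    (hs : ‖cisTransform τ t‖ ≤ ε / 4) : -ε < (cisTransform σ (⌊t⌋ : ℤ)).re := by
  -- The frequency `2π` puts `t - δ` within `δ` of an integer `m`, so `m < t < m + 2δ` and the floor
  -- is determined.
  obtain ⟨m, hm⟩ := exists_int_abs_sub_lt hδ (hcos (2 * Real.pi) (Finset.mem_insert_self _ _))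
  have hm' := abs_lt.1 hm
  have hfl : ⌊t⌋ = m := Int.floor_eq_iff.2 ⟨by linarith, by linarith⟩
  rw [hfl]
  have h1 : 0 ≤ ∑ θ ∈ F, σ.real {θ} * Real.cos (m * θ) := by
    refine Finset.sum_nonneg fun θ hθ => mul_nonneg measureReal_nonneg ?_
    have h2 := hcos θ (Finset.mem_insert_of_mem hθ)
    have h3 := norm_cis_sub_cis_le (θ * (t - δ)) (m * θ)
    have h4 : |θ * (t - δ) - m * θ| ≤ 2 * Real.pi * δ := by
      rw [mul_comm (m : ℝ), ← mul_sub, abs_mul]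
      exact mul_le_mul (hFI θ hθ) hm.le (abs_nonneg _) (by positivity)
    have h5 := (Complex.re_le_norm _).trans (h3.trans h4)
    rw [Complex.sub_re, cis_re, cis_re] at h5
    have := Real.pi_lt_four
    nlinarith
  -- Replacing `t` by `m` costs at most `ε / 4`, by the Lipschitz bound and the choice of `δ`.
  have h6 : ‖cisTransform τ m‖ ≤ ε / 2 := by
    have h7 := norm_cisTransform_sub_le τ hτ m t
    have h8 : |(m : ℝ) - t| ≤ 2 * δ := abs_le.2 ⟨by linarith, by linarith⟩
    have h9 : |(m : ℝ) - t| * (2 * Real.pi) * τ.real Set.univ ≤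
        2 * δ * (2 * Real.pi) * τ.real Set.univ := by gcongr
    have h10 := norm_sub_norm_le (cisTransform τ m) (cisTransform τ t)
    linarith
  have := hdec m
  linarith

open Classical in
/-- The times `n` at which `v ⌊f(n)⌋, …, v ⌊f(n + L)⌋` are all almost nonnegative have positive
lower density. -/
lemma IsWeight.exists_density {V : ℕ → ℝ} (hV : IsWeight V) {ℓ : ℕ} {f : ℕ → ℝ} {α c : ℝ}
    (hα : α ≠ 0) (hf : Tendsto (fun n => (fwdDiff (1 : ℕ))^[ℓ] f n - α * V n) atTop (nhds c))
    {v : ℤ → ℝ} (hv : IsPosDef v) {ε : ℝ} (hε : 0 < ε) (L : ℕ) :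
    ∃ κ > 0, ∀ᶠ w in windows V, κ * (V w.2 - V w.1) ≤
      ∑ n ∈ Finset.Ico w.1 w.2 with ∀ h ≤ L, -ε < v ⌊f (n + h)⌋, fwdDiff (1 : ℕ) V n := by
  obtain ⟨σ, hσf, hσI, hσv⟩ := hv.exists_measure
  obtain ⟨F, τ, hτσ, hτa, hFσ, hdec⟩ := exists_atoms_add_noAtoms σ (show 0 < ε / 4 by positivity)
  have hτf : IsFiniteMeasure τ := isFiniteMeasure_of_le σ hτσ
  have hIcc : ∀ θ ∈ Set.Icc 0 (2 * Real.pi), |θ| ≤ 2 * Real.pi := fun θ hθ => by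
    rw [abs_of_nonneg hθ.1]; exact hθ.2
  have hFI : ∀ θ ∈ F, |θ| ≤ 2 * Real.pi := fun θ hθ => hIcc θ <| by
    by_contra hcon
    exact hFσ θ hθ (measure_mono_null (Set.singleton_subset_iff.2 hcon) hσI)
  have hτI : ∀ᵐ θ ∂τ, |θ| ≤ 2 * Real.pi := by
    have h0 : ∀ᵐ θ ∂τ, θ ∈ Set.Icc 0 (2 * Real.pi) :=
      mem_ae_iff.2 (le_antisymm ((hτσ _).trans hσI.le) zero_le)
    exact h0.mono hIcc
  set C := τ.real Set.univ with hC
  have hC0 : 0 ≤ C := measureReal_nonneg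
  obtain ⟨δ, hδ, hδ1, hδ2⟩ : ∃ δ > 0, δ ≤ 1 / 100 ∧ 2 * δ * (2 * Real.pi) * C ≤ ε / 4 := by
    have hpos : 0 < ε / (16 * Real.pi * (C + 1)) := by positivity
    refine ⟨min (1 / 100) (ε / (16 * Real.pi * (C + 1))), lt_min (by norm_num) hpos,
      min_le_left _ _, ?_⟩
    have h1 := min_le_right (1 / 100) (ε / (16 * Real.pi * (C + 1)))
    have h2 : ε / (16 * Real.pi * (C + 1)) * (16 * Real.pi * (C + 1)) = ε := by
      field_simp
    have h3 : 0 < min (1 / 100) (ε / (16 * Real.pi * (C + 1))) := lt_min (by norm_num) hpos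
    have h4 := mul_le_mul_of_nonneg_right h1 (show 0 ≤ 16 * Real.pi * (C + 1) by positivity)
    have h5 : 0 < min (1 / 100) (ε / (16 * Real.pi * (C + 1))) * Real.pi := by positivity
    linarith
  obtain ⟨c', hf'⟩ := exists_tendsto_fwdDiff_iter_sub_const hf δ
  -- The Bohr conditions concern `θ (f (n + h) - δ)`, that is the polynomial `θ X ^ h` applied to `f
  -- - δ`, for every atom `θ`, for `θ = 2π` and for all `h ≤ L`.
  obtain ⟨κ, hκ, K, hK1, hKB, hKd⟩ := hV.exists_kernel hα hf'
    (insert (2 * Real.pi) F ×ˢ Finset.range (L + 1))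
    (fun i => Polynomial.monomial i.2 i.1) (show 0 < 8 * δ ^ 2 by positivity)
  let Q : ℕ → ℝ := fun n => ∑ h ∈ Finset.range (L + 1), ‖cisTransform τ (f (n + h))‖ ^ 2
  have hQ0 : ∀ n, 0 ≤ Q n := fun n => Finset.sum_nonneg fun _ _ => sq_nonneg _
  have hQ : Tendsto (wavg V fun n => (Q n : ℂ)) (windows V) (nhds 0) := by
    have h1 := tendsto_finsetSum (Finset.range (L + 1)) fun h _ =>
      hV.tendsto_wavg_norm_cisTransform_sq hα hf τ h
    rw [Finset.sum_const_zero] at h1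
    refine h1.congr fun p => ?_
    simp only [Q, Complex.ofReal_sum, wavg_sum]
  have hgood : ∀ n, κ < K n → Q n < (ε / 4) ^ 2 → ∀ h ≤ L, -ε < v ⌊f (n + h)⌋ :=
    fun n hn hq h hh => by
      have hmem : h ∈ Finset.range (L + 1) := Finset.mem_range.2 (by omega)
      have h1 : ‖cisTransform τ (f (n + h))‖ ≤ ε / 4 := by
        refine (lt_of_pow_lt_pow_left₀ 2 (by positivity) (lt_of_le_of_lt ?_ hq)).le
        exact Finset.single_le_sum (f := fun h => ‖cisTransform τ (f (n + h))‖ ^ 2)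
          (fun _ _ => sq_nonneg _) hmem
      have h2 := neg_lt_of_bohr hFI hτI hdec hδ hδ1 hδ2 hε (fun θ hθ => ?_) h1
      · rwa [hσv, Complex.ofReal_re] at h2
      · have := hKB n hn (θ, h) (Finset.mem_product.2 ⟨hθ, hmem⟩)
        rwa [shiftComb_monomial] at this
  refine ⟨κ / 2, by positivity, ?_⟩
  filter_upwards [hKd, (Metric.tendsto_nhds.1 hQ) (κ / 2 * (ε / 4) ^ 2) (by positivity),
    IsWeight.eventually_gt (V := V) 0, hV.eventually_le] with w h1 h2 h3 h4
  rw [wavg_ofReal, Complex.ofReal_re, le_div_iff₀ h3] at h1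
  rw [dist_zero_right, wavg_ofReal, Complex.norm_real] at h2
  have h5 := (le_abs_self _).trans_lt h2
  rw [div_lt_iff₀ h3] at h5
  -- A good `n` is covered by the first term since `K ≤ 1`, the case `K n ≤ κ` by the second, and a
  -- large `Q n` by the third (Markov's inequality). On average `2κ` is at most the good density
  -- plus `κ + κ / 2`.
  have hpt : ∀ n, fwdDiff (1 : ℕ) V n * K n ≤
      (if ∀ h ≤ L, -ε < v ⌊f (n + h)⌋ then fwdDiff (1 : ℕ) V n else 0) +
        κ * fwdDiff (1 : ℕ) V n + fwdDiff (1 : ℕ) V n * Q n / (ε / 4) ^ 2 := fun n => by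
    have hw := hV.nonneg n
    have hq : 0 ≤ Q n / (ε / 4) ^ 2 := div_nonneg (hQ0 n) (by positivity)
    have hif : 0 ≤ if ∀ h ≤ L, -ε < v ⌊f (n + h)⌋ then fwdDiff (1 : ℕ) V n else 0 := by
      split_ifs <;> simp [hw]
    rw [mul_div_assoc]
    by_cases hk : κ < K n
    · by_cases hq' : Q n < (ε / 4) ^ 2
      · rw [if_pos (hgood n hk hq')]
        nlinarith [hK1 n, mul_nonneg hw hq, mul_nonneg hκ.le hw]
      · have : 1 ≤ Q n / (ε / 4) ^ 2 := (one_le_div (by positivity)).2 (not_lt.1 hq')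
        nlinarith [hK1 n, mul_nonneg hκ.le hw]
    · nlinarith [mul_nonneg hw hq]
  have h6 := Finset.sum_le_sum fun n (_ : n ∈ Finset.Ico w.1 w.2) => hpt n
  rw [Finset.sum_add_distrib, Finset.sum_add_distrib, ← Finset.mul_sum, sum_Ico_fwdDiff V h4,
    ← Finset.sum_div, ← Finset.sum_filter] at h6
  have h7 : (∑ n ∈ Finset.Ico w.1 w.2, fwdDiff (1 : ℕ) V n * Q n) / (ε / 4) ^ 2 <
      κ / 2 * (V w.2 - V w.1) := by
    rw [div_lt_iff₀ (by positivity)]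
    linarith
  linarith

/-! ### From `W` to a weight, and from density to syndeticity. -/

lemma fwdDiff_iter_mem_classF {ℓ k : ℕ} {f : ℕ → ℝ} (hf : f ∈ ClassF (ℓ + k)) :
    (fwdDiff (1 : ℕ))^[ℓ] f ∈ ClassF k := by
  induction ℓ generalizing f with
  | zero => simpa using hf
  | succ ℓ ih =>
    rw [add_right_comm] at hf
    exact ih hf

lemma isWeight_of_antitoneOn {U : ℕ → ℝ} {n₀ : ℕ}
    (hanti : AntitoneOn (fwdDiff (1 : ℕ) U) (Set.Ici n₀))
    (hlim : Tendsto (fwdDiff (1 : ℕ) U) atTop (nhds 0))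
    (habs : Tendsto (fun N : ℕ => |∑ n ∈ Finset.Icc 1 N, fwdDiff (1 : ℕ) U n|) atTop atTop) :
    IsWeight fun n => U (n + n₀) := by
  have hd : fwdDiff (1 : ℕ) (fun n => U (n + n₀)) = fun n => fwdDiff (1 : ℕ) U (n + n₀) := by
    ext n; simp [fwdDiff, add_right_comm]
  have ha : Antitone (fwdDiff (1 : ℕ) fun n => U (n + n₀)) := by
    rw [hd]
    exact fun m n hmn => hanti (by simp) (by simp) (by omega)
  have hl : Tendsto (fwdDiff (1 : ℕ) fun n => U (n + n₀)) atTop (nhds 0) := by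
    rw [hd]; exact hlim.comp (tendsto_add_atTop_nat n₀)
  have hmono : Monotone fun n => U (n + n₀) := monotone_nat_of_le_succ fun n => by
    simpa [fwdDiff] using ha.le_of_tendsto hl n
  refine ⟨ha, hl, ?_⟩
  suffices h : Tendsto U atTop atTop from h.comp (tendsto_add_atTop_nat n₀)
  have h1 : ∀ N : ℕ, ∑ n ∈ Finset.Icc 1 N, fwdDiff (1 : ℕ) U n = U (N + 1) - U 1 := fun N => by
    have := sum_Ico_fwdDiff U (show 1 ≤ N + 1 by omega)
    rwa [← Order.succ_eq_add_one N, Finset.Ico_succ_right_eq_Icc] at this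
  simp only [h1] at habs
  refine (tendsto_add_atTop_iff_nat 1).1 (tendsto_atTop.2 fun b => ?_)
  filter_upwards [habs.eventually_gt_atTop (|b| + |U 1| + |U n₀|), eventually_ge_atTop n₀]
    with N hN hN0
  have h2 : U n₀ ≤ U (N + 1) := by
    simpa [Nat.sub_add_cancel (show n₀ ≤ N + 1 by omega)] using hmono (Nat.zero_le (N + 1 - n₀))
  have := le_abs_self b
  have := neg_abs_le (U n₀)
  have := abs_nonneg b
  have := abs_nonneg (U n₀)
  have := neg_abs_le (U 1)
  rcases abs_cases (U (N + 1) - U 1) with h | h <;> linarith [le_abs_self (U 1)]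

/-- A monotone `ΔW` tending to 0 has constant sign from some point on: decreasing gives a tail of
`W`, increasing a tail of `-W`. -/
lemma exists_isWeight {W : ℕ → ℝ} (hW : W ∈ ClassF 1) :
    ∃ n₀ > 0, IsWeight (fun n => W (n + n₀)) ∨ IsWeight (fun n => (-W) (n + n₀)) := by
  obtain ⟨⟨n₁, h⟩, hlim, habs⟩ := hW
  have hsub : Set.Ici (n₁ + 1) ⊆ Set.Ici n₁ := Set.Ici_subset_Ici.2 n₁.le_succ
  refine ⟨n₁ + 1, n₁.succ_pos, ?_⟩
  rcases h with h | h
  · have hneg : fwdDiff (1 : ℕ) (-W) = -fwdDiff (1 : ℕ) W := by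
      ext n; simp only [fwdDiff, Pi.neg_apply]; ring
    refine Or.inr (isWeight_of_antitoneOn ?_ ?_ ?_)
    · rw [hneg]; exact (h.mono hsub).neg
    · rw [hneg, ← neg_zero]; exact hlim.neg
    · simpa [hneg] using habs
  · exact Or.inl (isWeight_of_antitoneOn (h.mono hsub) hlim habs)

open Classical in
-- Only indices below `n₀` can have the wrong sign, and they contribute at most `B` in total. The
-- density bound therefore has to produce `1 + B` on the part of the window beyond `n₀`.
lemma isWSyndetic_of_density {U : ℕ → ℝ} {n₀ : ℕ} (hV : IsWeight fun n => U (n + n₀)) {R : Set ℕ}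
    {κ : ℝ} (hκ : 0 < κ)
    (hR : ∀ᶠ w in windows fun n => U (n + n₀), κ * (U (w.2 + n₀) - U (w.1 + n₀)) ≤
      ∑ n ∈ Finset.Ico w.1 w.2 with n + n₀ ∈ R, fwdDiff (1 : ℕ) (fun n => U (n + n₀)) n) :
    IsWSyndetic U R ∧ IsWSyndetic (-U) R := by
  set d := fwdDiff (1 : ℕ) U with hd
  have hdV : ∀ n, fwdDiff (1 : ℕ) (fun n => U (n + n₀)) n = d (n + n₀) := fun n => by
    simp [hd, fwdDiff, add_right_comm]
  have hd0 : ∀ n, n₀ ≤ n → 0 ≤ d n := fun n hn => by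
    have := hV.nonneg (n - n₀)
    rwa [hdV, Nat.sub_add_cancel hn] at this
  set B := ∑ n ∈ Finset.range n₀, |d n| with hB
  have hB0 : 0 ≤ B := Finset.sum_nonneg fun _ _ => abs_nonneg _
  have hvar : ∀ M N, M ≤ N → N ≤ n₀ → |U N - U M| ≤ B := fun M N hMN hN => by
    rw [← sum_Ico_fwdDiff U hMN]
    refine (Finset.abs_sum_le_sum_abs _ _).trans
      (Finset.sum_le_sum_of_subset_of_nonneg (fun n hn => ?_) fun _ _ _ => abs_nonneg _)
    rw [Finset.mem_Ico] at hn
    exact Finset.mem_range.2 (by omega)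
  have hmono : ∀ M N, n₀ ≤ M → M ≤ N → U M ≤ U N := fun M N hM hMN => by
    have := hV.monotone (show M - n₀ ≤ N - n₀ by omega)
    simpa only [Nat.sub_add_cancel hM, Nat.sub_add_cancel (hM.trans hMN)] using this
  constructor
  · obtain ⟨l₁, hl₁⟩ := mem_atTop_sets.1 (mem_comap'.1 hR)
    -- Cutting the window at `n₀` loses at most `B` of the increase of `U`. What remains is past the
    -- threshold `l₁` and at least `(1 + B) / κ`.
    obtain ⟨l, hl⟩ := exists_nat_gt (B + max l₁ ((1 + B) / κ))
    have hmax1 := le_max_left l₁ ((1 + B) / κ)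
    have hmax2 := le_max_right l₁ ((1 + B) / κ)
    have hpos : 0 < (1 + B) / κ := by positivity
    refine ⟨l, by exact_mod_cast (show (0 : ℝ) < l by linarith), fun M N _ hMN hle => ?_⟩
    have hN : n₀ ≤ N := by
      by_contra! hcon
      have := (le_abs_self _).trans (hvar M N hMN hcon.le)
      linarith
    set M' := max M n₀ with hM'
    have hM'N : M' ≤ N := max_le hMN hN
    have hM'0 : n₀ ≤ M' := le_max_right _ _
    have hUM : U M' ≤ U M + B := by
      rcases le_total n₀ M with h | h
      · rw [hM', max_eq_left h]; linarith
      · rw [hM', max_eq_right h]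
        linarith [(le_abs_self _).trans (hvar M n₀ h le_rfl)]
    let G : ℕ → ℝ := fun n => if n ∈ R then d n else 0
    have hGabs : ∀ n, |G n| ≤ |d n| := fun n => by
      simp only [G]; split_ifs <;> simp
    have h1 : 1 + B ≤ ∑ n ∈ Finset.Ico M' N, G n := by
      have h2 := hl₁ (U N - U M') (by linarith) (x := (M' - n₀, N - n₀))
        (by simp [Nat.sub_add_cancel hM'0, Nat.sub_add_cancel hN])
      simp only [Set.mem_ofPred_eq, Nat.sub_add_cancel hM'0, Nat.sub_add_cancel hN, hdV,
        Finset.sum_filter] at h2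
      have h3 := Finset.sum_Ico_add' G (M' - n₀) (N - n₀) n₀
      rw [Nat.sub_add_cancel hM'0, Nat.sub_add_cancel hN] at h3
      rw [← h3]
      refine le_trans ?_ h2
      have h4 : (1 + B) / κ ≤ U N - U M' := by linarith
      rw [div_le_iff₀ hκ] at h4
      linarith
    have h5 : -B ≤ ∑ n ∈ Finset.Icc M N with n < n₀, G n := by
      have h6 : |∑ n ∈ Finset.Icc M N with n < n₀, G n| ≤ B := by
        refine (Finset.abs_sum_le_sum_abs _ _).trans ((Finset.sum_le_sum fun n _ => hGabs n).trans
          (Finset.sum_le_sum_of_subset_of_nonneg (fun n hn => ?_) fun _ _ _ => abs_nonneg _))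
        exact Finset.mem_range.2 (Finset.mem_filter.1 hn).2
      exact (abs_le.1 h6).1
    have h7 : ∑ n ∈ Finset.Ico M' N, G n ≤ ∑ n ∈ Finset.Icc M N with ¬ n < n₀, G n := by
      refine Finset.sum_le_sum_of_subset_of_nonneg (fun n hn => ?_) fun n hn _ => ?_
      · rw [Finset.mem_Ico, hM', max_le_iff] at hn
        exact Finset.mem_filter.2 ⟨Finset.mem_Icc.2 ⟨hn.1.1, hn.2.le⟩, by omega⟩
      · have := hd0 n (not_lt.1 (Finset.mem_filter.1 hn).2)
        simp only [G]; split_ifs <;> simp [this]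
    rw [Finset.sum_filter, ← Finset.sum_filter_add_sum_filter_not _ (fun n => n < n₀)]
    linarith
  -- As `U` increases beyond `n₀`, `-U` never rises by more than `B`; the condition for `-U` is
  -- vacuous.
  · obtain ⟨l, hl⟩ := exists_nat_gt B
    refine ⟨l, by exact_mod_cast hB0.trans_lt hl, fun M N _ hMN hle => ?_⟩
    exfalso
    simp only [Pi.neg_apply] at hle
    rcases le_total n₀ M with h | h
    · linarith [hmono M N h hMN]
    · rcases le_total n₀ N with h' | h'
      · linarith [hmono n₀ N le_rfl h', (abs_le.1 (hvar M n₀ h le_rfl)).1]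
      · linarith [(abs_le.1 (hvar M N hMN h')).1]

/-- The conclusions for a sequence `f` whose `ℓ`-th difference is a multiple of `U`. -/
lemma isThick_and_isWSyndetic {U f : ℕ → ℝ} {n₀ ℓ : ℕ} (hn₀ : 0 < n₀)
    (hV : IsWeight fun n => U (n + n₀)) {α : ℝ} (hα : α ≠ 0)
    (hf : ∀ n, (fwdDiff (1 : ℕ))^[ℓ] f n = α * U n) {X : Type*} [MeasurableSpace X]
    {μ : Measure X} [IsProbabilityMeasure μ] {T : X ≃ᵐ X} (hT : MeasurePreserving T μ μ) {A : Set X}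
    (hA : MeasurableSet A) {ε : ℝ} (hε : 0 < ε) :
    IsThick (returnSet μ T f A ε) ∧ IsWSyndetic U (returnSet μ T f A ε) ∧
      IsWSyndetic (-U) (returnSet μ T f A ε) := by
  classical
  have hg : Tendsto (fun n => (fwdDiff (1 : ℕ))^[ℓ] (fun n => f (n + n₀)) n - α * U (n + n₀))
      atTop (nhds 0) := by
    refine tendsto_const_nhds.congr fun n => ?_
    rw [fwdDiff_iter_comp_add, hf, sub_self]
  have hmem : ∀ n, n + n₀ ∈ returnSet μ T f A ε ↔ -ε < correlation μ T A ⌊f (n + n₀)⌋ := fun n => by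
    simp only [returnSet, Set.mem_ofPred_eq, correlation, show 0 < n + n₀ by omega, true_and]
    constructor <;> intro h <;> linarith
  refine ⟨fun L => ?_, ?_⟩
  · obtain ⟨κ, hκ, hd⟩ := hV.exists_density hα hg (isPosDef_correlation hT hA) hε L
    have := hV.neBot
    obtain ⟨w, hw, hpos⟩ := (hd.and (IsWeight.eventually_gt 0)).exists
    have hne := Finset.nonempty_of_sum_ne_zero ((mul_pos hκ hpos).trans_le hw).ne'
    obtain ⟨n, hn⟩ := hne
    refine ⟨n + n₀, by omega, fun m hm => ?_⟩
    rw [Finset.mem_Icc] at hm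
    obtain ⟨h, rfl⟩ := Nat.exists_eq_add_of_le hm.1
    have := (Finset.mem_filter.1 hn).2 h (by omega)
    rw [add_right_comm]
    exact (hmem _).2 this
  · obtain ⟨κ, hκ, hd⟩ := hV.exists_density hα hg (isPosDef_correlation hT hA) hε 0
    refine isWSyndetic_of_density hV hκ (hd.mono fun w hw => ?_)
    simpa only [hmem, nonpos_iff_eq_zero, forall_eq, add_zero] using hw

theorem mainTheorem3 (ℓ : ℕ) (f : ℕ → ℝ) (hf : f ∈ ClassF (ℓ + 1))
    (W : ℕ → ℝ) (hW : W = (fwdDiff (1 : ℕ))^[ℓ] f)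
    {X : Type*} [MeasurableSpace X] (μ : MeasureTheory.Measure X)
    [MeasureTheory.IsProbabilityMeasure μ]
    (T : X ≃ᵐ X) (hT : MeasureTheory.MeasurePreserving T μ μ)
    (A : Set X) (hA : MeasurableSet A) (ε : ℝ) (hε : 0 < ε) :
    IsThick (returnSet μ T f A ε) ∧
      IsWSyndetic W (returnSet μ T f A ε) ∧
      IsWSyndetic (-W) (returnSet μ T f A ε) := by
  obtain ⟨n₀, hn₀, hV | hV⟩ := exists_isWeight (hW ▸ fwdDiff_iter_mem_classF hf)
  · exact isThick_and_isWSyndetic hn₀ hV one_ne_zero (fun n => by rw [hW, one_mul]) hT hA hε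
  -- The weight is a tail of `-W`, so `α = -1`.
  · have h := isThick_and_isWSyndetic (ℓ := ℓ) (f := f) hn₀ hV (neg_ne_zero.2 one_ne_zero)
      (fun n => by rw [hW]; simp) hT hA hε
    rw [neg_neg] at h
    exact ⟨h.1, h.2.2, h.2.1⟩
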